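/- Let $A$ be a finite alphabet and let $\mathcal C$ be a set of regular languages over $A$ that contains $\emptyset$ and $A^*$ and is closed under union, intersection, complement, and left and right quotients $L\mapsto w^{-1}L=\{v: wv\in L\}$ and $L\mapsto Lw^{-1}=\{v : vw\in L\}$ for all words $w\in A^*$. *Concatenation hierarchy.* For a set $\mathcal D$ of languages over $A$, let $\mathrm{Pol}(\mathcal D)$ be the set of all finite unions of languages of the form $L_0a_1L_1a_2L_2\cdots a_mL_m$ with $m\ge 0$, $L_0,\dots,L_m\in\mathcal D$ and $a_1,\dots,a_m\in A$, and let $\mathrm{Bool}(\mathcal D)$ be the smallest Boolean algebra of languages over $A$ containing $\mathcal D$. Put $\mathcal C[0]=\mathcal C$, and for all $n\in\mathbb N$ put $\mathcal C[n+\tfrac12]=\mathrm{Pol}(\mathcal C[n])$ and $\mathcal C[n+1]=\mathrm{Bool}(\mathcal C[n+\tfrac12])$. *Logic.* View a word $w=b_1\cdots b_\ell\in A^*$ as a structure with domain its set of positions $\{1,\dots,\ell\}$ (empty if $w=\varepsilon$). Let $\mathrm{FO}(\mathcal C)$ be first-order logic (without equality) over the following predicates: for each $a\in A$, the unary predicate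 $a(i)$, which holds when $b_i=a$; and for each $L\in\mathcal C$, the binary predicate $I_L(i,j)$, which holds when $i<j$ and $b_{i+1}\cdots b_{j-1}\in L$, the unary predicates $P_L(i)$, which holds when $b_1\cdots b_{i-1}\in L$, and $S_L(i)$, which holds when $b_{i+1}\cdots b_\ell\in L$, and the nullary predicate $N_L$, which holds when $w\in L$. A sentence $\varphi$ defines the language $\{w\in A^* : w\models\varphi\}$. *Quantifier alternation.* The $\Sigma_0(\mathcal C)$ and the $\Pi_0(\mathcal C)$ formulas are the quantifier-free formulas of $\mathrm{FO}(\mathcal C)$. For $n\ge 0$, the sets of $\Sigma_{n+1}(\mathcal C)$ and of $\Pi_{n+1}(\mathcal C)$ formulas are the smallest sets such that each of them contains all $\Sigma_n(\mathcal C)$ and all $\Pi_n(\mathcal C)$ formulas and is closed under $\vee$ and $\wedge$, the negation of a formula of either set belongs to the other set, $\Sigma_{n+1}(\mathcal C)$ is closed under $\exists x$, and $\Pi_{n+1}(\mathcal C)$ is closed under $\forall x$. (These are the formulas whose quantifiers can be pulled out, in the usual way, to a prenex formula with at most $n+1$ alternating blocks of quantifiers that, if it has $n+1$ blocks, starts with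 $\exists$, respectively $\forall$.) A $B\Sigma_n(\mathcal C)$ formula is a finite Boolean combination of $\Sigma_n(\mathcal C)$ formulas. **Theorem.** For every $n\in\mathbb N$ and every language $L\subseteq A^*$: 1. $L\in\mathcal C[n]$ if and only if $L$ is defined by a $B\Sigma_n(\mathcal C)$ sentence; 2. $L\in\mathcal C[n+\tfrac12]$ if and only if $L$ is defined by a $\Sigma_{n+1}(\mathcal C)$ sentence. -/

import Mathlib

universe u

namespace ConcatHierarchy

/-! ### Classes of languages -/

/-- A class of languages over `A` is a set of languages over `A`. It is a quotienting Boolean algebra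
when it contains `∅` and `A*` and is closed under union, intersection, complement, and left and
right quotients by words. -/
structure IsQuotientingBooleanAlgebra {A : Type u} (C : Set (Language A)) : Prop where
  bot_mem : (⊥ : Language A) ∈ C
  top_mem : (⊤ : Language A) ∈ C
  sup_mem : ∀ K ∈ C, ∀ L ∈ C, K ⊔ L ∈ C
  inf_mem : ∀ K ∈ C, ∀ L ∈ C, K ⊓ L ∈ C
  compl_mem : ∀ L ∈ C, Lᶜ ∈ C
  leftQuotient_mem : ∀ L ∈ C, ∀ w : List A, ({v | w ++ v ∈ L} : Set (List A)) ∈ C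
  rightQuotient_mem : ∀ L ∈ C, ∀ w : List A, ({v | v ++ w ∈ L} : Set (List A)) ∈ C

/-- `C`-monomials: the languages `L₀ a₁ L₁ a₂ L₂ ⋯ aₙ Lₙ` with `n ≥ 0`, all `Lᵢ` in `C` and all `aᵢ`
letters. -/
inductive IsMonomial {A : Type u} (C : Set (Language A)) : Language A → Prop
  | base {L : Language A} : L ∈ C → IsMonomial C L
  | concat {L M : Language A} (a : A) :
      L ∈ C → IsMonomial C M → IsMonomial C (L * {[a]} * M)

/-- The polynomial closure of `C`: all finite unions of `C`-monomials. -/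
def Pol {A : Type u} (C : Set (Language A)) : Set (Language A) :=
  {L | ∃ S : Finset (Language A), (∀ M ∈ S, IsMonomial C M) ∧ L = S.sup id}

/-- The Boolean closure of `C`: the smallest Boolean algebra of languages containing `C`. -/
def BoolClosure {A : Type u} (C : Set (Language A)) : Set (Language A) :=
  (BooleanSubalgebra.closure C : Set (Language A))

/-- The full level `C[n]` of the concatenation hierarchy of basis `C`:
`C[0] = C` and `C[n+1] = BoolClosure (Pol (C[n]))`. -/
def fullLevel {A : Type u} (C : Set (Language A)) : ℕ → Set (Language A)
  | 0 => C
  | n + 1 => BoolClosure (Pol (fullLevel C n))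

/-- The half level `C[n + 1/2] = Pol (C[n])` of the concatenation hierarchy of basis `C`. -/
def halfLevel {A : Type u} (C : Set (Language A)) (n : ℕ) : Set (Language A) :=
  Pol (fullLevel C n)

/-! ### The logic `FO(C)` -/

/-- The predicate symbols attached to `C`, indexed by arity: a unary label predicate for each letter,
and for each `L ∈ C` a binary `I_L`, unary `P_L` and `S_L`, and a nullary `N_L`. -/
inductive Pred {A : Type u} (C : Set (Language A)) : ℕ → Type u
  | label (a : A) : Pred C 1
  | I (L : C) : Pred C 2
  | P (L : C) : Pred C 1
  | S (L : C) : Pred C 1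
  | N (L : C) : Pred C 0

/-- The signature attached to `C`: the above predicate symbols and no function symbols. -/
def signature {A : Type u} (C : Set (Language A)) : FirstOrder.Language.{0, u} where
  Functions := fun _ => Empty
  Relations := Pred C

/-- The positions of the word `w`, numbered from `0` to `|w| - 1`. There are none in the empty word. -/
def Pos {A : Type u} (w : List A) : Type := Fin w.length

/-- The position seen as a natural number. -/
def Pos.val {A : Type u} {w : List A} (i : Pos w) : ℕ := Fin.val i

/-- Interpretation of the predicate symbols in the word `w`. For positions `i < j`, counted from `0`,
the infix of the letters strictly between them is `(w.take j).drop (i + 1)`, the prefix strictly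
before `i` is `w.take i`, and the suffix strictly after `i` is `w.drop (i + 1)`. -/
def interp {A : Type u} {C : Set (Language A)} (w : List A) :
    {k : ℕ} → Pred C k → (Fin k → Pos w) → Prop
  | _, .label a, x => w[(x 0).val]? = some a
  | _, .I L, x => (x 0).val < (x 1).val ∧ (w.take (x 1).val).drop ((x 0).val + 1) ∈ L.1
  | _, .P L, x => w.take (x 0).val ∈ L.1
  | _, .S L, x => w.drop ((x 0).val + 1) ∈ L.1
  | _, .N L, _ => w ∈ L.1

/-- The word `w` as a relational structure on its positions. -/
instance wordStructure {A : Type u} (C : Set (Language A)) (w : List A) :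
    (signature C).Structure (Pos w) where
  funMap := fun f _ => Empty.elim f
  RelMap := fun R x => interp w R x

/-- The language defined by a sentence: the words that satisfy it. -/
def languageOf {A : Type u} {C : Set (Language A)} (φ : (signature C).Sentence) : Language A :=
  ({w | φ.Realize (Pos w)} : Set (List A))

/-! ### Quantifier alternation -/

/-- The two kinds of fragments, `Σ` (leading block existential) and `Π` (leading block universal). -/
inductive Kind
  | sigma
  | pi

/-- Negation exchanges the two kinds. -/
def Kind.dual : Kind → Kind
  | .sigma => .pi
  | .pi => .sigma

/-- `IsAlt .sigma n φ` and `IsAlt .pi n φ` say that `φ` is a `Σₙ`, resp. `Πₙ`, formula: the parse tree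
of `φ` has at most `n` alternating blocks of quantifiers, the outermost block of a branch with `n`
blocks being existential, resp. universal, where a quantifier in the scope of an odd number of
negations counts as its dual. Equivalently, pulling out the quantifiers in the usual way turns `φ`
into a prenex formula with at most `n` blocks that starts, if it has `n` blocks, with `∃`, resp. `∀`.

The level `0` consists of the quantifier-free formulas. The connectives `¬`, `∨`, `∧`, `⊤` and the
quantifier `∃` are abbreviations in terms of the primitives `→`, `⊥` and `∀`, and the rules below
give: both fragments are closed under `∧` and `∨`, negation exchanges them, `Σₙ₊₁` is closed under `∃`
and `Πₙ₊₁` under `∀`, and `Σₙ` and `Πₙ` are contained in `Σₙ₊₁` and in `Πₙ₊₁`. There is no rule for the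
equality symbol, which is not part of the logic. -/
inductive IsAlt {A : Type u} {C : Set (Language A)} {α : Type} :
    Kind → ℕ → {k : ℕ} → (signature C).BoundedFormula α k → Prop
  | falsum {q : Kind} {n k : ℕ} :
      IsAlt q n (FirstOrder.Language.BoundedFormula.falsum (L := signature C) (α := α) (n := k))
  | rel {q : Kind} {n k l : ℕ} (R : (signature C).Relations l)
      (ts : Fin l → (signature C).Term (α ⊕ Fin k)) :
      IsAlt q n (FirstOrder.Language.BoundedFormula.rel R ts)
  | imp {q : Kind} {n k : ℕ} {φ ψ : (signature C).BoundedFormula α k} :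
      IsAlt q.dual n φ → IsAlt q n ψ → IsAlt q n (φ.imp ψ)
  | all {n k : ℕ} {φ : (signature C).BoundedFormula α (k + 1)} :
      IsAlt .pi (n + 1) φ → IsAlt .pi (n + 1) φ.all
  | succ {q q' : Kind} {n k : ℕ} {φ : (signature C).BoundedFormula α k} :
      IsAlt q n φ → IsAlt q' (n + 1) φ

/-- `Σₙ(C)` formulas. -/
def IsSigma {A : Type u} {C : Set (Language A)} {α : Type} (n : ℕ) {k : ℕ}
    (φ : (signature C).BoundedFormula α k) : Prop :=
  IsAlt .sigma n φ

/-- `BΣₙ(C)` formulas: the (finite) Boolean combinations of `Σₙ(C)` formulas. -/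
inductive IsBSigma {A : Type u} {C : Set (Language A)} {α : Type} (n : ℕ) {k : ℕ} :
    (signature C).BoundedFormula α k → Prop
  | sigma {φ : (signature C).BoundedFormula α k} : IsSigma n φ → IsBSigma n φ
  | falsum : IsBSigma n FirstOrder.Language.BoundedFormula.falsum
  | imp {φ ψ : (signature C).BoundedFormula α k} :
      IsBSigma n φ → IsBSigma n ψ → IsBSigma n (φ.imp ψ)

end ConcatHierarchy

/-! From languages to logic: a marked product `K a M` is defined by `∃ x, a(x) ∧ φ ∧ ψ`, where `φ`
speaks of the prefix before `x` and `ψ` of the suffix after `x`. Relativizing a formula to a prefix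
or suffix leaves its alternation unchanged, because the predicates of a prefix or suffix are again
predicates of the whole word (`IsAlt.exists_relativization`). Unions and Boolean operations are
connectives.

From logic to languages: free variables become marked positions, and the claim becomes a quantifier
elimination (`IsAlt.isLevelQF`). The marked words satisfying a `Σₙ₊₁` formula are a positive
combination of conditions "this mark has letter `a`", "these marks coincide", "the factor between
these marks is in `L`", with `L` in `C[n+1/2]`; for `Πₙ₊₁` formulas this holds of the complement.
With no marks left, only membership of the whole word in a language remains.

An existential quantifier forgets a mark (`QF.image_init`). That mark either sits on another one or
lies in a gap between neighbouring marks. In a gap, the conditions split into conditions on the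
other marks, on the factor `M` before the forgotten mark, on its letter `a`, and on the factor `N`
after it. Such a position exists exactly when the whole factor in the gap is in `M a N`.

The splitting needs the languages to be cuttable: `u a v ∈ L` must be a finite disjunction of
conditions `u ∈ K ∧ v ∈ M`. The basis is cuttable by regularity and closure under quotients, and
both `Pol` and `BoolClosure` preserve the property. Cuttability also makes `Pol` closed under
intersection. -/

namespace ConcatHierarchy

/-! ### Finite unions -/

/-- The finite joins of members of `F`. -/
inductive FinUnion {β : Type*} [Lattice β] [OrderBot β] (F : Set β) : β → Prop
  | basic {x : β} : x ∈ F → FinUnion F x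
  | bot : FinUnion F ⊥
  | sup {x y : β} : FinUnion F x → FinUnion F y → FinUnion F (x ⊔ y)

namespace FinUnion

variable {β γ : Type*}

/-- Lets an operation that commutes with finite joins be checked on generators only. Cuts, marked
products and intersections are all reduced to rectangles or monomials in this way. -/
theorem map [Lattice β] [OrderBot β] [Lattice γ] [OrderBot γ] {F : Set β} {G : Set γ}
    (f : β → γ) (hbot : f ⊥ = ⊥) (hsup : ∀ x y, f (x ⊔ y) = f x ⊔ f y)
    (hf : ∀ x ∈ F, FinUnion G (f x)) {x : β} (hx : FinUnion F x) : FinUnion G (f x) := by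
  induction hx with
  | basic h => exact hf _ h
  | bot => rw [hbot]; exact .bot
  | sup _ _ h₁ h₂ => rw [hsup]; exact .sup h₁ h₂

theorem mono [Lattice β] [OrderBot β] {F G : Set β} (h : F ⊆ G) {x : β} (hx : FinUnion F x) :
    FinUnion G x :=
  hx.map id rfl (fun _ _ => rfl) fun _ hy => .basic (h hy)

theorem inf [DistribLattice β] [OrderBot β] {F : Set β}
    (hF : ∀ x ∈ F, ∀ y ∈ F, FinUnion F (x ⊓ y)) {x y : β} (hx : FinUnion F x)
    (hy : FinUnion F y) : FinUnion F (x ⊓ y) :=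
  hx.map (· ⊓ y) (by simp) (fun _ _ => inf_sup_right _ _ _) fun x hx =>
    hy.map (x ⊓ ·) (by simp) (fun _ _ => inf_sup_left _ _ _) fun y hy => hF x hx y hy

theorem compl [BooleanAlgebra β] {F : Set β} (htop : FinUnion F ⊤)
    (hinf : ∀ x ∈ F, ∀ y ∈ F, FinUnion F (x ⊓ y)) (hcompl : ∀ x ∈ F, FinUnion F xᶜ) {x : β}
    (hx : FinUnion F x) : FinUnion F xᶜ := by
  induction hx with
  | basic h => exact hcompl _ h
  | bot => simpa using htop
  | sup _ _ h₁ h₂ => rw [compl_sup]; exact h₁.inf hinf h₂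

end FinUnion

/-! ### Lattices of languages -/

section Languages

variable {A : Type u}

/-- Lattices of languages containing the empty and the full language. -/
structure IsLatticeClass (D : Set (Language A)) : Prop where
  bot_mem : (⊥ : Language A) ∈ D
  top_mem : (⊤ : Language A) ∈ D
  sup_mem : ∀ K ∈ D, ∀ L ∈ D, K ⊔ L ∈ D
  inf_mem : ∀ K ∈ D, ∀ L ∈ D, K ⊓ L ∈ D

theorem IsQuotientingBooleanAlgebra.isLatticeClass {C : Set (Language A)}
    (hC : IsQuotientingBooleanAlgebra C) : IsLatticeClass C :=
  ⟨hC.bot_mem, hC.top_mem, hC.sup_mem, hC.inf_mem⟩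

theorem isLatticeClass_boolClosure (D : Set (Language A)) : IsLatticeClass (BoolClosure D) where
  bot_mem := BooleanSubalgebra.bot_mem
  top_mem := BooleanSubalgebra.top_mem
  sup_mem _ hK _ hL := BooleanSubalgebra.sup_mem hK hL
  inf_mem _ hK _ hL := BooleanSubalgebra.inf_mem hK hL

theorem subset_boolClosure (D : Set (Language A)) : D ⊆ BoolClosure D :=
  BooleanSubalgebra.subset_closure

/-- The language of the words with property `p`. -/
def language (p : List A → Prop) : Language A := ({w | p w} : Set (List A))

theorem mem_language {p : List A → Prop} {w : List A} : w ∈ language p ↔ p w := Iff.rfl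

theorem mem_mul_singleton_mul {K M : Language A} {a : A} {w : List A} :
    w ∈ K * {[a]} * M ↔ ∃ u v, u ∈ K ∧ v ∈ M ∧ u ++ a :: v = w := by
  constructor
  · rintro ⟨_, ⟨u, hu, _, rfl, rfl⟩, v, hv, rfl⟩
    exact ⟨u, v, hu, hv, by simp⟩
  · rintro ⟨u, v, hu, hv, rfl⟩
    exact ⟨u ++ [a], ⟨u, hu, [a], rfl, rfl⟩, v, hv, by simp⟩

/-- Two letters singled out in the same word are at the same place, or the first is to the left of
the second, or to its right. The case analyses on marked products rest on this trichotomy. -/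
theorem append_cons_eq_append_cons {a b : A} {u v x y : List A} :
    u ++ a :: x = v ++ b :: y ↔ (u = v ∧ a = b ∧ x = y) ∨
      (∃ z, v = u ++ a :: z ∧ x = z ++ b :: y) ∨ ∃ z, u = v ++ b :: z ∧ y = z ++ a :: x := by
  constructor
  · intro h
    rcases List.append_eq_append_iff.1 h with ⟨s, hs, h⟩ | ⟨s, hs, h⟩
    · cases s <;> simp_all
    · cases s <;> simp_all
  · rintro (⟨rfl, rfl, rfl⟩ | ⟨z, rfl, rfl⟩ | ⟨z, rfl, rfl⟩) <;> simp

/-! ### The polynomial closure as a lattice -/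

theorem mem_pol_iff {D : Set (Language A)} {L : Language A} :
    L ∈ Pol D ↔ FinUnion {M | IsMonomial D M} L := by
  classical
  constructor
  · rintro ⟨S, hS, rfl⟩
    induction S using Finset.induction_on with
    | empty => exact .bot
    | insert M S _ ih =>
      rw [Finset.sup_insert]
      exact .sup (.basic (hS _ (by simp))) (ih fun N hN => hS N (by simp [hN]))
  · intro h
    induction h with
    | @basic M h => exact ⟨{M}, by simpa using h, by simp⟩
    | bot => exact ⟨∅, by simp, by simp⟩
    | sup _ _ h₁ h₂ =>
      obtain ⟨S, hS, rfl⟩ := h₁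
      obtain ⟨T, hT, rfl⟩ := h₂
      refine ⟨S ∪ T, fun M hM => ?_, by rw [Finset.sup_union]⟩
      exact (Finset.mem_union.1 hM).elim (hS M) (hT M)

theorem subset_pol (D : Set (Language A)) : D ⊆ Pol D :=
  fun _ h => mem_pol_iff.2 (.basic (.base h))

theorem bot_mem_pol (D : Set (Language A)) : ⊥ ∈ Pol D := mem_pol_iff.2 .bot

theorem sup_mem_pol {D : Set (Language A)} {K L : Language A} (hK : K ∈ Pol D)
    (hL : L ∈ Pol D) : K ⊔ L ∈ Pol D :=
  mem_pol_iff.2 (.sup (mem_pol_iff.1 hK) (mem_pol_iff.1 hL))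

/-- Monomials are built by adding factors on the left, so the left operand is taken apart and
reassociated. -/
theorem IsMonomial.mul {D : Set (Language A)} {K M : Language A} (a : A) (hK : IsMonomial D K)
    (hM : IsMonomial D M) : IsMonomial D (K * {[a]} * M) := by
  induction hK with
  | base h => exact .concat a h hM
  | concat b h _ ih =>
    have := IsMonomial.concat b h ih
    simpa only [mul_assoc] using this

/-- The lattice operations `⊥` and `⊔` on languages are definitionally the semiring operations `0`
and `+`; the semiring laws are recast for rewriting. -/
theorem bot_mul_lang (L : Language A) : ⊥ * L = ⊥ := zero_mul L

theorem mul_bot_lang (L : Language A) : L * ⊥ = ⊥ := mul_zero L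

theorem sup_mul_lang (K L M : Language A) : (K ⊔ L) * M = K * M ⊔ L * M := add_mul K L M

theorem mul_sup_lang (K L M : Language A) : K * (L ⊔ M) = K * L ⊔ K * M := mul_add K L M

theorem mul_mem_pol {D : Set (Language A)} {K M : Language A} (a : A) (hK : K ∈ Pol D)
    (hM : M ∈ Pol D) : K * {[a]} * M ∈ Pol D := by
  rw [mem_pol_iff] at *
  refine hK.map (fun K => K * {[a]} * M) (by simp only [bot_mul_lang])
    (fun x y => by simp only [sup_mul_lang]) fun K hK => ?_
  exact hM.map (fun M => K * {[a]} * M) (by simp only [mul_bot_lang])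
    (fun x y => by simp only [mul_sup_lang]) fun M hM => .basic (hK.mul a hM)

/-! ### Cutting a language at a letter -/

/-- The rectangles with sides in `D`. -/
def rects (D : Set (Language A)) : Set (Set (List A × List A)) :=
  {R | ∃ K ∈ D, ∃ M ∈ D, R = {p | p.1 ∈ K ∧ p.2 ∈ M}}

/-- A class is cuttable if, for each of its languages `L` and each letter `a`, the set of all `(u, v)`
with `u a v ∈ L` is a finite union of rectangles with sides in the class. -/
def Cuttable (D : Set (Language A)) : Prop :=
  ∀ L ∈ D, ∀ a : A, FinUnion (rects D) {p | p.1 ++ a :: p.2 ∈ L}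

theorem rects_mono {D E : Set (Language A)} (h : D ⊆ E) : rects D ⊆ rects E := by
  rintro _ ⟨K, hK, M, hM, rfl⟩
  exact ⟨K, h hK, M, h hM, rfl⟩

theorem finUnion_rects_inf {D : Set (Language A)} (hD : IsLatticeClass D) :
    ∀ R ∈ rects D, ∀ S ∈ rects D, FinUnion (rects D) (R ⊓ S) := by
  rintro _ ⟨K, hK, M, hM, rfl⟩ _ ⟨K', hK', M', hM', rfl⟩
  refine .basic ⟨K ⊓ K', hD.inf_mem _ hK _ hK', M ⊓ M', hD.inf_mem _ hM _ hM', ?_⟩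
  ext p
  change (_ ∧ _) ∧ (_ ∧ _) ↔ (_ ∧ _) ∧ (_ ∧ _)
  tauto

theorem finUnion_rects_compl {D : Set (Language A)} (hD : IsLatticeClass D)
    (hc : ∀ L ∈ D, Lᶜ ∈ D) {R : Set (List A × List A)} (hR : FinUnion (rects D) R) :
    FinUnion (rects D) Rᶜ := by
  have htop : (⊤ : Set (List A × List A)) ∈ rects D := by
    refine ⟨⊤, hD.top_mem, ⊤, hD.top_mem, ?_⟩
    ext p
    exact ⟨fun _ => ⟨trivial, trivial⟩, fun _ => trivial⟩
  refine FinUnion.compl (.basic htop) (finUnion_rects_inf hD) ?_ hR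
  · rintro _ ⟨K, hK, M, hM, rfl⟩
    -- The complement of a rectangle is the union of two rectangles that each have one full side.
    have h : {p : List A × List A | p.1 ∈ K ∧ p.2 ∈ M}ᶜ =
        {p | p.1 ∈ Kᶜ ∧ p.2 ∈ (⊤ : Language A)} ⊔ {p | p.1 ∈ (⊤ : Language A) ∧ p.2 ∈ Mᶜ} := by
      ext p
      change ¬ (_ ∧ _) ↔ (¬ _ ∧ True) ∨ (True ∧ ¬ _)
      tauto
    rw [h]
    exact .sup (.basic ⟨_, hc _ hK, _, hD.top_mem, rfl⟩) (.basic ⟨_, hD.top_mem, _, hc _ hM, rfl⟩)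

/-- For fixed `a`, the set of `(u, v)` with `u a v ∈ L` is a preimage of `L`, hence commutes with
unions and complements, and finite unions of rectangles over a Boolean algebra are closed under
both. -/
theorem Cuttable.boolClosure {D : Set (Language A)} (hD : Cuttable D) :
    Cuttable (BoolClosure D) := by
  intro L hL a
  induction hL using BooleanSubalgebra.closure_bot_sup_induction with
  | mem L hL => exact (hD L hL a).mono (rects_mono (subset_boolClosure D))
  | bot => exact .bot
  | sup K _ L _ hK hL => exact .sup hK hL
  | compl L _ hL =>
    exact finUnion_rects_compl (isLatticeClass_boolClosure D)
      (fun _ h => BooleanSubalgebra.compl_mem h) hL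

/-- In a word of `L c M`, the cutting letter is the separator `c` itself (`h₁`), or lies in the
factor from `L` (`h₂`), or lies in the factor from `M` (`h₃`). -/
theorem IsMonomial.finUnion_rects {D : Set (Language A)} (hD : Cuttable D) {L : Language A}
    (hL : IsMonomial D L) (a : A) : FinUnion (rects (Pol D)) {p | p.1 ++ a :: p.2 ∈ L} := by
  induction hL with
  | base h => exact (hD _ h a).mono (rects_mono (subset_pol D))
  | @concat L M c hL hM ih =>
    have hM' : M ∈ Pol D := mem_pol_iff.2 (.basic hM)
    have h₁ : FinUnion (rects (Pol D)) {p | a = c ∧ p.1 ∈ L ∧ p.2 ∈ M} := by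
      by_cases h : a = c
      · exact .basic ⟨L, subset_pol D hL, M, hM', by simp [h]⟩
      · simpa [h] using FinUnion.bot (F := rects (Pol D))
    -- A rectangle `K × N` in the cut of `L` becomes `K × (N c M)`.
    have h₂ := (hD L hL a).map (G := rects (Pol D))
      (fun R => {p | ∃ z x, (p.1, z) ∈ R ∧ x ∈ M ∧ z ++ c :: x = p.2})
      (by ext; simp) (by intro R S; ext; simp [or_and_right, exists_or]) (by
        rintro _ ⟨K, hK, N, hN, rfl⟩
        refine .basic ⟨K, subset_pol D hK, _, mul_mem_pol c (subset_pol D hN) hM', ?_⟩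
        ext p
        simp [mem_mul_singleton_mul, and_assoc])
    -- A rectangle `K × N` in the cut of `M` becomes `(L c K) × N`.
    have h₃ := ih.map (G := rects (Pol D))
      (fun R => {p | ∃ u z, u ∈ L ∧ (z, p.2) ∈ R ∧ u ++ c :: z = p.1})
      (by ext; simp) (by intro R S; ext; simp [or_and_right, and_or_left, exists_or]) (by
        rintro _ ⟨K, hK, N, hN, rfl⟩
        refine .basic ⟨_, mul_mem_pol c (subset_pol D hL) hK, N, hN, ?_⟩
        ext p
        simp only [mem_mul_singleton_mul, Set.mem_ofPred_eq]
        constructor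
        · rintro ⟨u, z, h1, ⟨h2, h3⟩, h4⟩
          exact ⟨⟨u, z, h1, h2, h4⟩, h3⟩
        · rintro ⟨⟨u, z, h1, h2, h4⟩, h3⟩
          exact ⟨u, z, h1, ⟨h2, h3⟩, h4⟩)
    convert (h₁.sup h₂).sup h₃ using 1
    ext ⟨u, v⟩
    simp only [Set.mem_ofPred_eq, mem_mul_singleton_mul, Set.sup_eq_union, Set.mem_union]
    constructor
    · rintro ⟨x, y, hx, hy, h⟩
      rcases append_cons_eq_append_cons.1 h with ⟨rfl, rfl, rfl⟩ | ⟨z, rfl, rfl⟩ | ⟨z, rfl, rfl⟩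
      · exact .inl (.inl ⟨rfl, hx, hy⟩)
      · exact .inr ⟨x, z, hx, hy, rfl⟩
      · exact .inl (.inr ⟨z, y, hx, hy, rfl⟩)
    · rintro ((⟨rfl, hx, hy⟩ | ⟨z, y, hx, hy, rfl⟩) | ⟨x, z, hx, hy, rfl⟩)
      · exact ⟨u, v, hx, hy, rfl⟩
      · exact ⟨_, y, hx, hy, by simp⟩
      · exact ⟨x, _, hx, hy, by simp⟩

theorem Cuttable.pol {D : Set (Language A)} (hD : Cuttable D) : Cuttable (Pol D) := fun _ hL a =>
  (mem_pol_iff.1 hL).map (fun L : Language A => {p : List A × List A | p.1 ++ a :: p.2 ∈ L}) rfl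
    (fun _ _ => rfl) fun _ hM => IsMonomial.finUnion_rects hD hM a

/-! ### Intersections of polynomials -/

/-- The part of `(K b Y) ∩ (L a X)` where the letter `a` is read inside `K`. -/
theorem Cuttable.inf_aux {D : Set (Language A)} (hD : Cuttable D) (hl : IsLatticeClass D)
    {K L X Y : Language A} {a b : A} (hK : K ∈ D) (hL : L ∈ D)
    (h : ∀ N ∈ D, X ⊓ (N * {[b]} * Y) ∈ Pol D) :
    language (fun w => ∃ u z y, u ∈ L ∧ u ++ a :: z ∈ K ∧ y ∈ Y ∧ z ++ b :: y ∈ X ∧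
      u ++ a :: (z ++ b :: y) = w) ∈ Pol D := by
  rw [mem_pol_iff]
  refine (hD K hK a).map (γ := Language A) (fun R => language fun w => ∃ u z y, u ∈ L ∧
    (u, z) ∈ R ∧ y ∈ Y ∧ z ++ b :: y ∈ X ∧ u ++ a :: (z ++ b :: y) = w) ?_ ?_ ?_
  · refine Language.ext fun w => ⟨?_, fun h => h.elim⟩
    rintro ⟨u, z, y, _, h, _⟩
    exact h.elim
  · intro R S
    refine Language.ext fun w => ⟨?_, ?_⟩
    · rintro ⟨u, z, y, h₁, h | h, h₂⟩
      · exact .inl ⟨u, z, y, h₁, h, h₂⟩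
      · exact .inr ⟨u, z, y, h₁, h, h₂⟩
    · rintro (⟨u, z, y, h₁, h, h₂⟩ | ⟨u, z, y, h₁, h, h₂⟩)
      · exact ⟨u, z, y, h₁, .inl h, h₂⟩
      · exact ⟨u, z, y, h₁, .inr h, h₂⟩
  · rintro _ ⟨M, hM, N, hN, rfl⟩
    rw [← mem_pol_iff]
    -- A rectangle `M × N` in the cut of `K` contributes `(L ∩ M) a (X ∩ N b Y)`.
    convert mul_mem_pol a (subset_pol D (hl.inf_mem _ hL _ hM)) (h N hN) using 1
    refine Language.ext fun w => Iff.trans ?_ mem_mul_singleton_mul.symm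
    constructor
    · rintro ⟨u, z, y, h₁, ⟨h₂, h₃⟩, h₄, h₅, rfl⟩
      exact ⟨u, _, ⟨h₁, h₂⟩, ⟨h₅, mem_mul_singleton_mul.2 ⟨z, y, h₃, h₄, rfl⟩⟩, rfl⟩
    · rintro ⟨u, v, ⟨h₁, h₂⟩, ⟨h₅, h₆⟩, rfl⟩
      obtain ⟨z, y, h₃, h₄, rfl⟩ := mem_mul_singleton_mul.1 h₆
      exact ⟨u, z, y, h₁, ⟨h₂, h₃⟩, h₄, h₅, rfl⟩

/-- Cutting `L` at the first separator of `K a Y` gives a union of languages `(K ∩ M) a (N ∩ Y)`.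
The induction is over all `L` at once, as `N` replaces `L` in the shorter intersection. -/
theorem Cuttable.base_inf_mem {D : Set (Language A)} (hD : Cuttable D) (hl : IsLatticeClass D)
    {Y : Language A} (hY : IsMonomial D Y) : ∀ L ∈ D, L ⊓ Y ∈ Pol D := by
  induction hY with
  | base hK => exact fun L hL => subset_pol D (hl.inf_mem _ hL _ hK)
  | @concat K Y a hK hY ih =>
    intro L hL
    rw [mem_pol_iff]
    refine cast ?_ ((hD L hL a).map (γ := Language A) (G := {M | IsMonomial D M})
      (fun R => language fun w => ∃ u y, u ∈ K ∧ (u, y) ∈ R ∧ y ∈ Y ∧ u ++ a :: y = w) ?_ ?_ ?_)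
    · congr 1
      refine Language.ext fun w => ⟨?_, ?_⟩
      · rintro ⟨u, y, h₁, h₂, h₃, rfl⟩
        exact ⟨h₂, mem_mul_singleton_mul.2 ⟨u, y, h₁, h₃, rfl⟩⟩
      · rintro ⟨h₂, h⟩
        obtain ⟨u, y, h₁, h₃, rfl⟩ := mem_mul_singleton_mul.1 h
        exact ⟨u, y, h₁, h₂, h₃, rfl⟩
    · refine Language.ext fun w => ⟨?_, fun h => h.elim⟩
      rintro ⟨u, y, _, h, _⟩
      exact h.elim
    · intro R S
      refine Language.ext fun w => ⟨?_, ?_⟩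
      · rintro ⟨u, y, h₁, h | h, h₂⟩
        · exact .inl ⟨u, y, h₁, h, h₂⟩
        · exact .inr ⟨u, y, h₁, h, h₂⟩
      · rintro (⟨u, y, h₁, h, h₂⟩ | ⟨u, y, h₁, h, h₂⟩)
        · exact ⟨u, y, h₁, .inl h, h₂⟩
        · exact ⟨u, y, h₁, .inr h, h₂⟩
    · rintro _ ⟨M, hM, N, hN, rfl⟩
      rw [← mem_pol_iff]
      convert mul_mem_pol a (subset_pol D (hl.inf_mem _ hK _ hM)) (ih N hN) using 1
      refine Language.ext fun w => Iff.trans ?_ mem_mul_singleton_mul.symm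
      constructor
      · rintro ⟨u, y, h₁, ⟨h₂, h₃⟩, h₄, rfl⟩
        exact ⟨u, y, ⟨h₁, h₂⟩, ⟨h₃, h₄⟩, rfl⟩
      · rintro ⟨u, y, ⟨h₁, h₂⟩, ⟨h₃, h₄⟩, rfl⟩
        exact ⟨u, y, h₁, ⟨h₂, h₃⟩, h₄, rfl⟩

/-- The first separators of the two monomials are compared: they coincide, or one of them is read
inside the first factor of the other monomial, which is then cut there. Each case leaves an
intersection with fewer separators in total. -/
theorem Cuttable.monomial_inf_mem {D : Set (Language A)} (hD : Cuttable D)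
    (hl : IsLatticeClass D) {X : Language A} (hX : IsMonomial D X) :
    ∀ Y, IsMonomial D Y → X ⊓ Y ∈ Pol D := by
  induction hX with
  | base h => exact fun Y hY => hD.base_inf_mem hl hY _ h
  | @concat L X a hL hX ih =>
    intro Y hY
    -- When `b` is read inside `L`, what remains is `Y ∩ N a X` with a new first factor `N`, so `L`
    -- has to vary.
    induction hY generalizing L with
    | base h =>
      rw [inf_comm]
      exact hD.base_inf_mem hl (.concat a hL hX) _ h
    | @concat K Y b hK hY ihY =>
      have h₁ : language (fun w => a = b ∧ w ∈ (L ⊓ K) * {[a]} * (X ⊓ Y)) ∈ Pol D := by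
        by_cases h : a = b
        · convert mul_mem_pol a (subset_pol D (hl.inf_mem _ hL _ hK)) (ih Y hY) using 1
          exact Language.ext fun w => ⟨fun h => h.2, fun h' => ⟨h, h'⟩⟩
        · convert bot_mem_pol D using 1
          exact Language.ext fun w => ⟨fun h' => h h'.1, fun h => h.elim⟩
      have h₂ := hD.inf_aux hl (a := a) (b := b) (X := X) (Y := Y) hK hL
        fun N hN => ih _ (.concat b hN hY)
      have h₃ := hD.inf_aux hl (a := b) (b := a) (X := Y) (Y := X) hL hK
        fun N hN => by rw [inf_comm]; exact ihY hN
      convert sup_mem_pol (sup_mem_pol h₁ h₂) h₃ using 1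
      refine Language.ext fun w => ⟨?_, ?_⟩
      · rintro ⟨h, h'⟩
        obtain ⟨u, x, hu, hx, rfl⟩ := mem_mul_singleton_mul.1 h
        obtain ⟨v, y, hv, hy, e⟩ := mem_mul_singleton_mul.1 h'
        rcases append_cons_eq_append_cons.1 e with
          ⟨rfl, rfl, rfl⟩ | ⟨z, rfl, rfl⟩ | ⟨z, rfl, rfl⟩
        · exact .inl (.inl ⟨rfl, mem_mul_singleton_mul.2 ⟨v, y, ⟨hu, hv⟩, ⟨hx, hy⟩, rfl⟩⟩)
        · exact .inr ⟨v, z, x, hv, hu, hx, hy, by simp⟩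
        · exact .inl (.inr ⟨u, z, y, hu, hv, hy, hx, rfl⟩)
      · rintro ((⟨rfl, h⟩ | ⟨u, z, y, hu, hv, hy, hx, rfl⟩) | ⟨v, z, x, hv, hu, hx, hy, rfl⟩)
        · obtain ⟨u, x, h₁, h₂, rfl⟩ := mem_mul_singleton_mul.1 h
          exact ⟨mem_mul_singleton_mul.2 ⟨u, x, h₁.1, h₂.1, rfl⟩,
            mem_mul_singleton_mul.2 ⟨u, x, h₁.2, h₂.2, rfl⟩⟩
        · exact ⟨mem_mul_singleton_mul.2 ⟨u, _, hu, hx, rfl⟩,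
            mem_mul_singleton_mul.2 ⟨_, y, hv, hy, by simp⟩⟩
        · exact ⟨mem_mul_singleton_mul.2 ⟨_, x, hu, hx, by simp⟩,
            mem_mul_singleton_mul.2 ⟨v, _, hv, hy, rfl⟩⟩

theorem Cuttable.isLatticeClass_pol {D : Set (Language A)} (hD : Cuttable D)
    (hl : IsLatticeClass D) : IsLatticeClass (Pol D) where
  bot_mem := bot_mem_pol D
  top_mem := subset_pol D hl.top_mem
  sup_mem _ hK _ hL := sup_mem_pol hK hL
  inf_mem _ hK _ hL := mem_pol_iff.2 <| (mem_pol_iff.1 hK).inf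
    (fun _ hX _ hY => mem_pol_iff.1 (hD.monomial_inf_mem hl hX _ hY)) (mem_pol_iff.1 hL)

/-- The only place where regularity enters. Writing `Q` for the finitely many left quotients of `L`,
the set of `(u, v)` with `u a v ∈ L` is the union of the rectangles `{u | (ua)⁻¹L = Q} × Q`. The
right sides are in `C` as left quotients, the left sides as finite intersections of right quotients
of `L` and their complements. -/
theorem IsQuotientingBooleanAlgebra.cuttable {C : Set (Language A)}
    (hC : IsQuotientingBooleanAlgebra C) (hreg : ∀ L ∈ C, L.IsRegular) : Cuttable C := by
  classical
  intro L hL a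
  have hfin := Language.isRegular_iff_finite_range_leftQuotient.1 (hreg L hL)
  have hmem : ∀ u v : List A, v ∈ L.leftQuotient (u ++ [a]) ↔ u ++ a :: v ∈ L := fun u v => by
    rw [Language.mem_leftQuotient]
    simp
  -- A word `v` in exactly one of `Q` and `R` separates them: the right quotient of `L` by `a v`, or
  -- its complement, contains every `u` of class `Q` and no `u` of class `R`.
  have hsep : ∀ Q R : Language A, ∃ N ∈ C, ∀ u : List A, (L.leftQuotient (u ++ [a]) = Q → u ∈ N) ∧
      (R ≠ Q → L.leftQuotient (u ++ [a]) = R → u ∉ N) := by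
    intro Q R
    by_cases hR : R = Q
    · exact ⟨⊤, hC.top_mem, fun u => ⟨fun _ => trivial, fun h => (h hR).elim⟩⟩
    obtain ⟨v, hv⟩ : ∃ v, ¬ (v ∈ R ↔ v ∈ Q) := by
      by_contra! h
      exact hR (Language.ext h)
    have hN : language (fun u => u ++ a :: v ∈ L) ∈ C := hC.rightQuotient_mem L hL (a :: v)
    by_cases hQ : v ∈ Q
    · refine ⟨_, hN, fun u => ⟨?_, ?_⟩⟩
      · rintro rfl
        exact (hmem u v).1 hQ
      · rintro - rfl hu
        exact hv ⟨fun _ => hQ, fun _ => (hmem u v).2 hu⟩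
    · refine ⟨_, hC.compl_mem _ hN, fun u => ⟨?_, ?_⟩⟩
      · rintro rfl hu
        exact hQ ((hmem u v).2 hu)
      · rintro - rfl hu
        exact hv ⟨fun h => (hu ((hmem u v).1 h)).elim, fun h => (hQ h).elim⟩
  have hsepAll : ∀ (Q : Language A) (T : Set (Language A)), T.Finite → ∃ N ∈ C, ∀ u : List A,
      (L.leftQuotient (u ++ [a]) = Q → u ∈ N) ∧
      ∀ R ∈ T, R ≠ Q → L.leftQuotient (u ++ [a]) = R → u ∉ N := by
    intro Q T hT
    induction T, hT using Set.Finite.induction_on with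
    | empty => exact ⟨⊤, hC.top_mem, fun u => ⟨fun _ => trivial, by simp⟩⟩
    | @insert R T _ _ ih =>
      obtain ⟨N, hN, h⟩ := ih
      obtain ⟨N', hN', h'⟩ := hsep Q R
      refine ⟨N ⊓ N', hC.inf_mem _ hN _ hN', fun u => ⟨fun e => ⟨(h u).1 e, (h' u).1 e⟩, ?_⟩⟩
      rintro R' (rfl | hR') hne e ⟨h₁, h₂⟩
      · exact (h' u).2 hne e h₂
      · exact (h u).2 R' hR' hne e h₁
  -- Separating `Q` from every left quotient of `L` leaves exactly the class of `Q`.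
  have hcls : ∀ Q : Language A, language (fun u => L.leftQuotient (u ++ [a]) = Q) ∈ C := by
    intro Q
    obtain ⟨N, hN, h⟩ := hsepAll Q _ hfin
    convert hN using 1
    refine Language.ext fun u => ⟨(h u).1, fun hu => ?_⟩
    by_contra hne
    exact (h u).2 _ ⟨u ++ [a], rfl⟩ hne rfl hu
  have hunion : ∀ T ⊆ Set.range L.leftQuotient, T.Finite → FinUnion (rects C)
      {p | L.leftQuotient (p.1 ++ [a]) ∈ T ∧ p.2 ∈ L.leftQuotient (p.1 ++ [a])} := by
    intro T hsub hT
    induction T, hT using Set.Finite.induction_on with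
    | empty => simpa using FinUnion.bot (F := rects C)
    | @insert Q T _ _ ih =>
      rw [Set.insert_subset_iff] at hsub
      obtain ⟨⟨w, rfl⟩, hsub⟩ := hsub
      have hrect : {p : List A × List A | L.leftQuotient (p.1 ++ [a]) = L.leftQuotient w ∧
          p.2 ∈ L.leftQuotient w} ∈ rects C :=
        ⟨_, hcls (L.leftQuotient w), L.leftQuotient w, hC.leftQuotient_mem L hL w, rfl⟩
      convert FinUnion.sup (.basic hrect) (ih hsub) using 1
      ext p
      simp only [Set.mem_ofPred_eq, Set.mem_insert_iff, Set.sup_eq_union, Set.mem_union,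
        or_and_right]
      refine or_congr_left (and_congr_right fun e => ?_)
      rw [e]
  convert hunion _ subset_rfl hfin using 1
  ext p
  simp [hmem]

end Languages

/-! ### Words with marked positions -/

section Marked

variable {A : Type u}

/-- The factor of `w` from position `s` included to position `e` excluded. -/
def factor (w : List A) (s e : ℕ) : List A := (w.take e).drop s

theorem factor_cut {w : List A} {s i e : ℕ} (hs : s ≤ i) (hi : i < w.length) (he : i < e) :
    factor w s e = factor w s i ++ w[i] :: factor w (i + 1) e := by
  apply List.ext_getElem?
  intro n
  simp only [factor, List.getElem?_append, List.getElem?_drop, List.length_drop,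
    List.length_take, List.getElem?_take, List.getElem?_cons]
  split_ifs <;> grind

theorem exists_of_factor_eq {w : List A} {s e : ℕ} {u v : List A} {a : A}
    (h : factor w s e = u ++ a :: v) : ∃ (i : ℕ) (hi : i < w.length), s ≤ i ∧ i < e ∧
      w[i] = a ∧ factor w s i = u ∧ factor w (i + 1) e = v := by
  have hl := congrArg List.length h
  simp only [factor, List.length_drop, List.length_take, List.length_append,
    List.length_cons] at hl
  have hi : s + u.length < w.length := by omega
  have he : s + u.length < e := by omega
  have hc := factor_cut (w := w) (s := s) (i := s + u.length) (e := e) (by omega) hi he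
  rw [h] at hc
  have hlen : (factor w s (s + u.length)).length = u.length := by
    simp only [factor, List.length_drop, List.length_take]
    omega
  obtain ⟨h₁, h₂⟩ := List.append_inj hc hlen.symm
  obtain ⟨h₂, h₃⟩ := List.cons.inj h₂
  exact ⟨_, hi, by omega, he, h₂.symm, h₁.symm, h₃.symm⟩

theorem Pos.isLt {w : List A} (i : Pos w) : i.val < w.length := Fin.isLt i

theorem Pos.val_inj {w : List A} {i j : Pos w} : i.val = j.val ↔ i = j := Fin.ext_iff.symm

/-- A word with `k` marked positions. -/
abbrev Marked (A : Type u) (k : ℕ) : Type u := Σ w : List A, Fin k → Pos w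

namespace Marked

variable {k l : ℕ}

/-- Reindexing the marked positions. -/
def comap (f : Fin k → Fin l) (p : Marked A l) : Marked A k := ⟨p.1, p.2 ∘ f⟩

/-- The word with one more marked position. -/
def snoc (p : Marked A k) (x : Pos p.1) : Marked A (k + 1) := ⟨p.1, Fin.snoc p.2 x⟩

/-- Forgetting the last marked position. -/
def init (p : Marked A (k + 1)) : Marked A k := p.comap Fin.castSucc

theorem init_snoc (p : Marked A k) (x : Pos p.1) : (p.snoc x).init = p := by
  obtain ⟨w, xs⟩ := p
  simp only [init, comap, snoc]
  congr 1
  ext i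
  simp

/-- The first position after the marked position `y`, or the first position of the word. -/
def start (p : Marked A k) : Option (Fin k) → ℕ
  | none => 0
  | some i => (p.2 i).val + 1

/-- The marked position `z`, or the end of the word. -/
def finish (p : Marked A k) : Option (Fin k) → ℕ
  | none => p.1.length
  | some i => (p.2 i).val

theorem start_comap (f : Fin k → Fin l) (p : Marked A l) (y : Option (Fin k)) :
    (p.comap f).start y = p.start (y.map f) := by
  cases y <;> rfl

theorem finish_comap (f : Fin k → Fin l) (p : Marked A l) (y : Option (Fin k)) :
    (p.comap f).finish y = p.finish (y.map f) := by
  cases y <;> rfl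

/-- The words whose factor strictly between the marks `y` and `z` is in `L`. -/
def between (L : Language A) (y z : Option (Fin k)) : Set (Marked A k) :=
  {p | p.start y ≤ p.finish z ∧ factor p.1 (p.start y) (p.finish z) ∈ L}

/-- The words with letter `a` at the mark `i`. -/
def label (a : A) (i : Fin k) : Set (Marked A k) := {p | p.1[(p.2 i).val]? = some a}

/-- The words whose marks `i` and `j` are at the same position. -/
def same (i j : Fin k) : Set (Marked A k) := {p | p.2 i = p.2 j}

end Marked

open Marked

/-- The positive Boolean combinations of the atomic properties of words with `k` marked positions
that are given by languages in `D`. -/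
inductive QF (D : Set (Language A)) (k : ℕ) : Set (Marked A k) → Prop
  | empty : QF D k ∅
  | univ : QF D k Set.univ
  | union {R S : Set (Marked A k)} : QF D k R → QF D k S → QF D k (R ∪ S)
  | inter {R S : Set (Marked A k)} : QF D k R → QF D k S → QF D k (R ∩ S)
  | label (a : A) (i : Fin k) : QF D k (label a i)
  | same (i j : Fin k) : QF D k (same i j)
  | between {L : Language A} (h : L ∈ D) (y z : Option (Fin k)) : QF D k (between L y z)

namespace QF

variable {D : Set (Language A)} {k l : ℕ}

theorem mono {E : Set (Language A)} (h : D ⊆ E) {R : Set (Marked A k)} (hR : QF D k R) :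
    QF E k R := by
  induction hR with
  | empty => exact .empty
  | univ => exact .univ
  | union _ _ h₁ h₂ => exact .union h₁ h₂
  | inter _ _ h₁ h₂ => exact .inter h₁ h₂
  | label a i => exact .label a i
  | same i j => exact .same i j
  | between hL y z => exact .between (h hL) y z

theorem comap (f : Fin k → Fin l) {R : Set (Marked A k)} (hR : QF D k R) :
    QF D l (Marked.comap f ⁻¹' R) := by
  induction hR with
  | empty => exact .empty
  | univ => exact .univ
  | union _ _ h₁ h₂ => exact .union h₁ h₂
  | inter _ _ h₁ h₂ => exact .inter h₁ h₂
  | label a i => exact .label a (f i)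
  | same i j => exact .same (f i) (f j)
  | @between L hL y z =>
    convert QF.between hL (y.map f) (z.map f) using 1
    ext p
    simp only [Set.mem_preimage, Marked.between, Set.mem_ofPred_eq, start_comap, finish_comap]
    rfl

theorem iUnion {ι : Type*} [Finite ι] {R : ι → Set (Marked A k)} (hR : ∀ i, QF D k (R i)) :
    QF D k (⋃ i, R i) := by
  have h : ∀ T : Set ι, T.Finite → QF D k (⋃ i ∈ T, R i) := by
    intro T hT
    induction T, hT using Set.Finite.induction_on with
    | empty => simpa using QF.empty
    | insert _ _ ih => rw [Set.biUnion_insert]; exact .union (hR _) ih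
  simpa using h _ Set.finite_univ

theorem iInter {ι : Type*} [Finite ι] {R : ι → Set (Marked A k)} (hR : ∀ i, QF D k (R i)) :
    QF D k (⋂ i, R i) := by
  have h : ∀ T : Set ι, T.Finite → QF D k (⋂ i ∈ T, R i) := by
    intro T hT
    induction T, hT using Set.Finite.induction_on with
    | empty => simpa using QF.univ
    | insert _ _ ih => rw [Set.biInter_insert]; exact .inter (hR _) ih
  simpa using h _ Set.finite_univ

/-- With the full language, only the order of the marks is left. As `start` is one past the mark,
two marks are compared strictly. -/
theorem mem_between_top {y z : Option (Fin k)} {p : Marked A k} :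
    p ∈ Marked.between ⊤ y z ↔ p.start y ≤ p.finish z :=
  and_iff_left trivial

/-- Negated atoms are positive again: another letter of the finite alphabet, one mark before the
other, or a wrong order of the ends or a factor in the complement of the language. -/
theorem compl [Finite A] (hD : IsLatticeClass D) (hc : ∀ L ∈ D, Lᶜ ∈ D) {R : Set (Marked A k)}
    (hR : QF D k R) : QF D k Rᶜ := by
  induction hR with
  | empty => simpa using QF.univ
  | univ => simpa using QF.empty
  | union _ _ h₁ h₂ => rw [Set.compl_union]; exact .inter h₁ h₂
  | inter _ _ h₁ h₂ => rw [Set.compl_inter]; exact .union h₁ h₂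
  | label a i =>
    convert iUnion fun b : {b : A // b ≠ a} => QF.label (D := D) b.1 i using 1
    ext p
    have hp := (p.2 i).isLt
    simp [Marked.label, List.getElem?_eq_getElem hp, eq_comm]
  | same i j =>
    convert (QF.between hD.top_mem (some i) (some j)).union
      (QF.between hD.top_mem (some j) (some i)) using 1
    ext p
    simp only [Set.mem_compl_iff, Marked.same, Set.mem_ofPred_eq, Set.mem_union, mem_between_top,
      start, finish, Nat.succ_le_iff]
    rw [← Pos.val_inj]
    exact lt_or_lt_iff_ne.symm
  | @between L hL y z =>
    have hnot : QF D k {p | p.finish z < p.start y} := by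
      rcases y with - | i
      · convert QF.empty
        simp [start]
      rcases z with - | j
      · convert QF.empty
        ext p
        simpa [start, finish, Nat.succ_le_iff] using (p.2 i).isLt
      · convert (QF.same j i).union (QF.between hD.top_mem (some j) (some i)) using 1
        ext p
        simp only [Set.mem_ofPred_eq, Set.mem_union, mem_between_top, start, finish, Marked.same,
          Nat.succ_le_iff, Nat.lt_succ_iff]
        rw [le_iff_eq_or_lt, Pos.val_inj]
    convert hnot.union (QF.between (hc _ hL) y z) using 1
    ext p
    change ¬ (_ ∧ _) ↔ p.finish z < p.start y ∨ _ ∧ ¬ _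
    rw [← not_le]
    tauto

/-- Without marks, the only atoms concern the factor between the two ends, that is, the whole word.
-/
theorem mem_of_zero (hD : IsLatticeClass D) {R : Set (Marked A 0)} (hR : QF D 0 R) :
    language (fun w => (⟨w, Fin.elim0⟩ : Marked A 0) ∈ R) ∈ D := by
  induction hR with
  | empty => exact hD.bot_mem
  | univ => exact hD.top_mem
  | union _ _ h₁ h₂ => exact hD.sup_mem _ h₁ _ h₂
  | inter _ _ h₁ h₂ => exact hD.inf_mem _ h₁ _ h₂
  | label a i => exact i.elim0
  | same i => exact i.elim0
  | @between L hL y z =>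
    obtain rfl := Subsingleton.elim y none
    obtain rfl := Subsingleton.elim z none
    convert hL using 1
    refine Language.ext fun w => ?_
    simp [mem_language, Marked.between, start, finish, factor]

end QF

end Marked

/-! ### Elimination of a marked position -/

section Elimination

open Marked

variable {A : Type u} {D : Set (Language A)} {k : ℕ}

theorem FinUnion.iUnion {β ι : Type*} [Finite ι] {F : Set (Set β)} {R : ι → Set β}
    (hR : ∀ i, FinUnion F (R i)) : FinUnion F (⋃ i, R i) := by
  have h : ∀ T : Set ι, T.Finite → FinUnion F (⋃ i ∈ T, R i) := by
    intro T hT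
    induction T, hT using Set.Finite.induction_on with
    | empty => rw [Set.biUnion_empty]; exact .bot
    | insert _ _ ih => rw [Set.biUnion_insert]; exact .sup (hR _) ih
  simpa using h _ Set.finite_univ

namespace Marked

/-- The last marked position. -/
def last (q : Marked A (k + 1)) : ℕ := (q.2 (Fin.last k)).val

theorem last_lt (q : Marked A (k + 1)) : q.last < q.1.length := Pos.isLt _

theorem last_snoc (p : Marked A k) (x : Pos p.1) : (p.snoc x).last = x.val := by
  simp [last, snoc]

/-- The last mark is strictly between the marks `y` and `z`, and no other mark is. -/
def gap (y z : Option (Fin k)) : Set (Marked A (k + 1)) :=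
  {q | q.init.start y ≤ q.last ∧ q.last < q.init.finish z ∧
    ∀ i, (q.init.2 i).val < q.init.start y ∨ q.init.finish z ≤ (q.init.2 i).val}

/-- The last mark has letter `a`, the factor between `y` and it is in `M`, and that between it and
`z` is in `N`. -/
def box (y z : Option (Fin k)) (Q : Set (Marked A k)) (M : Language A) (a : A) (N : Language A) :
    Set (Marked A (k + 1)) :=
  {q | q.init ∈ Q ∧ factor q.1 (q.init.start y) q.last ∈ M ∧ q.1[q.last]? = some a ∧
    factor q.1 (q.last + 1) (q.init.finish z) ∈ N}

/-- The boxes with components in `D`. -/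
def boxes (D : Set (Language A)) (y z : Option (Fin k)) : Set (Set (Marked A (k + 1))) :=
  {R | ∃ Q M a N, QF D k Q ∧ M ∈ D ∧ N ∈ D ∧ R = box y z Q M a N}

/-- If the last mark is on no other mark, `y` and `z` are its nearest marks on the left and on the
right, or `none` for the ends of the word. -/
theorem exists_eq_or_mem_gap (q : Marked A (k + 1)) :
    (∃ i, q.2 (Fin.last k) = q.init.2 i) ∨ ∃ y z, q ∈ gap y z := by
  by_cases h : ∃ i, q.2 (Fin.last k) = q.init.2 i
  · exact .inl h
  right
  have hne : ∀ i, (q.init.2 i).val ≠ q.last := fun i hi => h ⟨i, (Pos.val_inj.1 hi).symm⟩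
  have hy : ∃ y, q.init.start y ≤ q.last ∧
      ∀ i, (q.init.2 i).val < q.last → (q.init.2 i).val < q.init.start y := by
    rcases Set.eq_empty_or_nonempty {i | (q.init.2 i).val < q.last} with he | hn
    · refine ⟨none, Nat.zero_le _, fun i hi => ?_⟩
      exact absurd (show i ∈ {i | (q.init.2 i).val < q.last} from hi) (he ▸ Set.notMem_empty i)
    · obtain ⟨j, hj, hmax⟩ :=
        Set.exists_max_image _ (fun i => (q.init.2 i).val) (Set.toFinite _) hn
      exact ⟨some j, hj, fun i hi => Nat.lt_succ_of_le (hmax i hi)⟩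
  have hz : ∃ z, q.last < q.init.finish z ∧
      ∀ i, q.last < (q.init.2 i).val → q.init.finish z ≤ (q.init.2 i).val := by
    rcases Set.eq_empty_or_nonempty {i | q.last < (q.init.2 i).val} with he | hn
    · refine ⟨none, q.last_lt, fun i hi => ?_⟩
      exact absurd (show i ∈ {i | q.last < (q.init.2 i).val} from hi) (he ▸ Set.notMem_empty i)
    · obtain ⟨j, hj, hmin⟩ :=
        Set.exists_min_image _ (fun i => (q.init.2 i).val) (Set.toFinite _) hn
      exact ⟨some j, hj, hmin⟩
  obtain ⟨y, hy, hy'⟩ := hy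
  obtain ⟨z, hz, hz'⟩ := hz
  exact ⟨y, z, hy, hz, fun i => (lt_or_gt_of_ne (hne i)).imp (hy' i) (hz' i)⟩

end Marked

/-! ### Splitting quantifier-free conditions inside a gap -/

/-- Within the gap between `y` and `z`, the set `R` is a finite union of boxes. -/
def IsLocal (D : Set (Language A)) (y z : Option (Fin k)) (R : Set (Marked A (k + 1))) : Prop :=
  ∃ S, FinUnion (boxes D y z) S ∧ ∀ q ∈ gap y z, q ∈ R ↔ q ∈ S

namespace IsLocal

variable {y z : Option (Fin k)}

theorem congr {R S : Set (Marked A (k + 1))} (hR : IsLocal D y z R)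
    (h : ∀ q ∈ gap y z, q ∈ S ↔ q ∈ R) : IsLocal D y z S := by
  obtain ⟨T, hT, h'⟩ := hR
  exact ⟨T, hT, fun q hq => (h q hq).trans (h' q hq)⟩

theorem empty : IsLocal D y z ∅ := ⟨∅, .bot, fun _ _ => Iff.rfl⟩

theorem union {R S : Set (Marked A (k + 1))} (hR : IsLocal D y z R) (hS : IsLocal D y z S) :
    IsLocal D y z (R ∪ S) := by
  obtain ⟨R', hR', h⟩ := hR
  obtain ⟨S', hS', h'⟩ := hS
  exact ⟨_, hR'.sup hS', fun q hq => or_congr (h q hq) (h' q hq)⟩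

theorem iUnion {ι : Type*} [Finite ι] {R : ι → Set (Marked A (k + 1))}
    (hR : ∀ i, IsLocal D y z (R i)) : IsLocal D y z (⋃ i, R i) := by
  choose S hS h using hR
  exact ⟨_, FinUnion.iUnion hS, fun q hq => by simp only [Set.mem_iUnion, h _ q hq]⟩

/-- Boxes with the same letter intersect componentwise, and boxes with different letters are
disjoint. -/
theorem inter (hD : IsLatticeClass D) {R S : Set (Marked A (k + 1))} (hR : IsLocal D y z R)
    (hS : IsLocal D y z S) : IsLocal D y z (R ∩ S) := by
  obtain ⟨R', hR', h⟩ := hR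
  obtain ⟨S', hS', h'⟩ := hS
  refine ⟨_, hR'.inf ?_ hS', fun q hq => and_congr (h q hq) (h' q hq)⟩
  rintro _ ⟨Q, M, a, N, hQ, hM, hN, rfl⟩ _ ⟨Q', M', a', N', hQ', hM', hN', rfl⟩
  by_cases haa : a = a'
  · subst haa
    refine .basic ⟨Q ∩ Q', M ⊓ M', a, N ⊓ N', hQ.inter hQ', hD.inf_mem _ hM _ hM',
      hD.inf_mem _ hN _ hN', ?_⟩
    ext q
    change (_ ∧ _ ∧ _ ∧ _) ∧ (_ ∧ _ ∧ _ ∧ _) ↔ (_ ∧ _) ∧ (_ ∧ _) ∧ _ ∧ (_ ∧ _)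
    tauto
  · suffices h : box y z Q M a N ⊓ box y z Q' M' a' N' = ∅ by rw [h]; exact .bot
    ext q
    refine ⟨fun ⟨h₁, h₂⟩ => haa ?_, fun h => h.elim⟩
    exact Option.some.inj (h₁.2.2.1.symm.trans h₂.2.2.1)

theorem of_factors [Finite A] {Q : Set (Marked A k)} {M N : Language A} (hQ : QF D k Q)
    (hM : M ∈ D) (hN : N ∈ D) : IsLocal D y z {q | q.init ∈ Q ∧
      factor q.1 (q.init.start y) q.last ∈ M ∧ factor q.1 (q.last + 1) (q.init.finish z) ∈ N} := by
  refine ⟨⋃ a, box y z Q M a N, FinUnion.iUnion fun a => .basic ⟨Q, M, a, N, hQ, hM, hN, rfl⟩,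
    fun q _ => ?_⟩
  simp [box, List.getElem?_eq_getElem q.last_lt]

theorem of_init [Finite A] (hD : IsLatticeClass D) {Q : Set (Marked A k)} (hQ : QF D k Q) :
    IsLocal D y z {q | q.init ∈ Q} :=
  (of_factors hQ hD.top_mem hD.top_mem).congr fun _ _ =>
    ⟨fun h => ⟨h, trivial, trivial⟩, fun h => h.1⟩

/-- The factor starting after `i` either starts where the gap does, and is then a side of the box,
or runs through the mark `y`. In the latter case `L` is cut at the letter of that mark: the left
piece is a condition on the other marks, the right piece a side of the box. -/
theorem between_left [Finite A] (hD : IsLatticeClass D) (hcut : Cuttable D) {L : Language A}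
    (hL : L ∈ D) (i : Option (Fin k)) : IsLocal D y z
      {q | q.init.start i ≤ q.last ∧ factor q.1 (q.init.start i) q.last ∈ L} := by
  have h₁ : IsLocal D y z
      {q | q.init.start i = q.init.start y ∧ factor q.1 (q.init.start y) q.last ∈ L} := by
    have hQ : QF D k {p | p.start i = p.start y} := by
      rcases i with - | i <;> rcases y with - | j
      · simpa [start] using QF.univ
      · simpa [start] using QF.empty
      · simpa [start] using QF.empty
      · simpa [start, Pos.val_inj, same] using QF.same i j
    exact (of_factors hQ hL hD.top_mem).congr fun q _ =>
      ⟨fun h => ⟨h.1, h.2, trivial⟩, fun h => ⟨h.1, h.2.1⟩⟩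
  rcases y with - | j
  · refine h₁.congr fun q hq => ?_
    rcases i with - | i
    · exact ⟨fun h => ⟨rfl, h.2⟩, fun h => ⟨Nat.zero_le _, h.2⟩⟩
    -- Both sides are false: no mark precedes this gap, so the mark `i` is at or beyond its right
    -- end.
    · have := hq.2.1
      have := hq.2.2 i
      simp only [start, finish, Set.mem_ofPred_eq] at *
      constructor <;> rintro ⟨h, -⟩ <;> omega
  · have h₂ : ∀ (a : A) {U : Set (List A × List A)}, FinUnion (rects D) U →
        IsLocal D (some j) z {q | q.init.start i ≤ q.init.finish (some j) ∧
          q.init ∈ label a j ∧ (factor q.1 (q.init.start i) (q.init.finish (some j)),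
            factor q.1 (q.init.start (some j)) q.last) ∈ U} := by
      intro a U hU
      induction hU with
      | basic h =>
        obtain ⟨K, hK, M, hM, rfl⟩ := h
        refine (of_factors ((QF.label a j).inter (QF.between hK i (some j))) hM
          hD.top_mem).congr fun q _ => ?_
        exact ⟨fun ⟨h₁, h₂, h₃, h₄⟩ => ⟨⟨h₂, h₁, h₃⟩, h₄, trivial⟩,
          fun ⟨⟨h₂, h₁, h₃⟩, h₄, _⟩ => ⟨h₁, h₂, h₃, h₄⟩⟩
      | bot => exact empty.congr fun q _ => ⟨fun h => h.2.2, fun h => h.elim⟩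
      | sup _ _ h h' =>
        refine (h.union h').congr fun q _ => ?_
        change _ ∧ _ ∧ (_ ∨ _) ↔ (_ ∧ _ ∧ _) ∨ (_ ∧ _ ∧ _)
        tauto
    refine (h₁.union (iUnion fun a => h₂ a (hcut L hL a))).congr fun q hq => ?_
    have hj : (q.init.2 j).val < q.1.length := (q.init.2 j).isLt
    have hjlast : (q.init.2 j).val < q.last := hq.1
    have hcutj : q.init.start i ≤ (q.init.2 j).val → (factor q.1 (q.init.start i) q.last ∈ L ↔
        factor q.1 (q.init.start i) (q.init.2 j).val ++ q.1[(q.init.2 j).val] ::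
          factor q.1 ((q.init.2 j).val + 1) q.last ∈ L) := fun h => by
      rw [factor_cut h hj hjlast]
    simp only [Set.mem_union, Set.mem_iUnion]
    constructor
    · rintro ⟨h, h'⟩
      -- No mark lies inside the gap, so a different starting point to the left of the last mark is
      -- at or before the mark `j`.
      by_cases he : q.init.start i = q.init.start (some j)
      · exact .inl ⟨he, he ▸ h'⟩
      · have hlt : q.init.start i ≤ (q.init.2 j).val := by
          rcases i with - | i
          · exact Nat.zero_le _
          · have := hq.2.1
            have := hq.2.2 i
            simp only [start] at *
            omega
        exact .inr ⟨_, hlt, List.getElem?_eq_getElem hj, (hcutj hlt).1 h'⟩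
    · rintro (⟨h, h'⟩ | ⟨a, h, ha, h'⟩)
      · exact ⟨h ▸ hjlast, h ▸ h'⟩
      · obtain rfl := Option.some.inj ((List.getElem?_eq_getElem hj).symm.trans ha)
        exact ⟨h.trans hjlast.le, (hcutj h).2 h'⟩

/-- Mirror image of `between_left`: a factor that runs past the right end of the gap is cut at the
mark `z`. -/
theorem between_right [Finite A] (hD : IsLatticeClass D) (hcut : Cuttable D) {L : Language A}
    (hL : L ∈ D) (i : Option (Fin k)) : IsLocal D y z
      {q | q.last + 1 ≤ q.init.finish i ∧ factor q.1 (q.last + 1) (q.init.finish i) ∈ L} := by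
  have h₁ : IsLocal D y z
      {q | q.init.finish i = q.init.finish z ∧ factor q.1 (q.last + 1) (q.init.finish z) ∈ L} := by
    have hQ : QF D k {p | p.finish i = p.finish z} := by
      rcases i with - | i <;> rcases z with - | j
      · simpa [finish] using QF.univ
      · convert QF.empty
        ext p
        simpa [finish] using (p.2 j).isLt.ne'
      · convert QF.empty
        ext p
        simpa [finish] using (p.2 i).isLt.ne
      · simpa [finish, Pos.val_inj, same] using QF.same i j
    exact (of_factors hQ hD.top_mem hL).congr fun q _ =>
      ⟨fun h => ⟨h.1, trivial, h.2⟩, fun h => ⟨h.1, h.2.2⟩⟩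
  rcases z with - | j
  · refine h₁.congr fun q hq => ?_
    rcases i with - | i
    · exact ⟨fun h => ⟨rfl, h.2⟩, fun h => ⟨q.last_lt, h.2⟩⟩
    · have := hq.1
      have := hq.2.2 i
      have := (q.init.2 i).isLt
      simp only [start, finish, Set.mem_ofPred_eq] at *
      constructor <;> rintro ⟨h, -⟩ <;> omega
  · have h₂ : ∀ (a : A) {U : Set (List A × List A)}, FinUnion (rects D) U →
        IsLocal D y (some j) {q | q.init.start (some j) ≤ q.init.finish i ∧
          q.init ∈ label a j ∧ (factor q.1 (q.last + 1) (q.init.finish (some j)),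
            factor q.1 (q.init.start (some j)) (q.init.finish i)) ∈ U} := by
      intro a U hU
      induction hU with
      | basic h =>
        obtain ⟨K, hK, M, hM, rfl⟩ := h
        refine (of_factors ((QF.label a j).inter (QF.between hM (some j) i)) hD.top_mem
          hK).congr fun q _ => ?_
        exact ⟨fun ⟨h₁, h₂, h₃, h₄⟩ => ⟨⟨h₂, h₁, h₄⟩, trivial, h₃⟩,
          fun ⟨⟨h₂, h₁, h₄⟩, _, h₃⟩ => ⟨h₁, h₂, h₃, h₄⟩⟩
      | bot => exact empty.congr fun q _ => ⟨fun h => h.2.2, fun h => h.elim⟩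
      | sup _ _ h h' =>
        refine (h.union h').congr fun q _ => ?_
        change _ ∧ _ ∧ (_ ∨ _) ↔ (_ ∧ _ ∧ _) ∨ (_ ∧ _ ∧ _)
        tauto
    refine (h₁.union (iUnion fun a => h₂ a (hcut L hL a))).congr fun q hq => ?_
    have hj : (q.init.2 j).val < q.1.length := (q.init.2 j).isLt
    have hjlast : q.last < (q.init.2 j).val := hq.2.1
    have hcutj : (q.init.2 j).val < q.init.finish i →
        (factor q.1 (q.last + 1) (q.init.finish i) ∈ L ↔
          factor q.1 (q.last + 1) (q.init.2 j).val ++ q.1[(q.init.2 j).val] ::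
            factor q.1 ((q.init.2 j).val + 1) (q.init.finish i) ∈ L) := fun h => by
      rw [factor_cut hjlast hj h]
    simp only [Set.mem_union, Set.mem_iUnion]
    constructor
    · rintro ⟨h, h'⟩
      by_cases he : q.init.finish i = q.init.finish (some j)
      · exact .inl ⟨he, he ▸ h'⟩
      · have hlt : (q.init.2 j).val < q.init.finish i := by
          rcases i with - | i
          · exact hj
          · have := hq.1
            have := hq.2.2 i
            simp only [finish] at *
            omega
        exact .inr ⟨_, hlt, List.getElem?_eq_getElem hj, (hcutj hlt).1 h'⟩
    · rintro (⟨h, h'⟩ | ⟨a, h, ha, h'⟩)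
      · exact ⟨h ▸ hjlast, h ▸ h'⟩
      · obtain rfl := Option.some.inj ((List.getElem?_eq_getElem hj).symm.trans ha)
        exact ⟨hjlast.trans h, (hcutj h).2 h'⟩

end IsLocal

theorem start_castSucc (q : Marked A (k + 1)) (y : Option (Fin k)) :
    q.start (y.map Fin.castSucc) = q.init.start y := (start_comap _ _ _).symm

theorem finish_castSucc (q : Marked A (k + 1)) (y : Option (Fin k)) :
    q.finish (y.map Fin.castSucc) = q.init.finish y := (finish_comap _ _ _).symm

theorem option_fin_succ_cases (y : Option (Fin (k + 1))) :
    y = some (Fin.last k) ∨ ∃ y' : Option (Fin k), y = y'.map Fin.castSucc := by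
  rcases y with - | i
  · exact .inr ⟨none, rfl⟩
  · induction i using Fin.lastCases with
    | last => exact .inl rfl
    | cast i => exact .inr ⟨some i, rfl⟩

/-- Atoms on the other marks are unaffected by the last one, equality of the last mark with another
fails in a gap, and a factor with one end at the last mark is split by `between_left` or
`between_right`. -/
theorem QF.isLocal [Finite A] (hD : IsLatticeClass D) (hcut : Cuttable D)
    {R : Set (Marked A (k + 1))} (hR : QF D (k + 1) R) (y z : Option (Fin k)) :
    IsLocal D y z R := by
  induction hR with
  | empty => exact .empty
  | univ => exact (IsLocal.of_init hD .univ).congr fun _ _ => Iff.rfl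
  | union _ _ h₁ h₂ => exact h₁.union h₂
  | inter _ _ h₁ h₂ => exact h₁.inter hD h₂
  | label a i =>
    induction i using Fin.lastCases with
    | last =>
      refine ⟨_, .basic ⟨Set.univ, ⊤, a, ⊤, .univ, hD.top_mem, hD.top_mem, rfl⟩, fun q _ => ?_⟩
      exact ⟨fun h => ⟨trivial, trivial, h, trivial⟩, fun h => h.2.2.1⟩
    | cast i => exact IsLocal.of_init hD (QF.label a i)
  | same i j =>
    have hne : ∀ i, ∀ q ∈ gap (A := A) y z, q.2 (Fin.last k) ≠ q.2 (Fin.castSucc i) := by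
      intro i q hq h
      have h₁ := hq.1
      have h₂ := hq.2.1
      have h₃ := hq.2.2 i
      have h₄ : q.last = (q.init.2 i).val := congrArg Pos.val h
      omega
    induction i using Fin.lastCases with
    | last =>
      induction j using Fin.lastCases with
      | last => exact (IsLocal.of_init hD .univ).congr fun _ _ => ⟨fun _ => trivial, fun _ => rfl⟩
      | cast j => exact IsLocal.empty.congr fun q hq => ⟨hne j q hq, fun h => h.elim⟩
    | cast i =>
      induction j using Fin.lastCases with
      | last => exact IsLocal.empty.congr fun q hq => ⟨fun h => hne i q hq h.symm, fun h => h.elim⟩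
      | cast j => exact IsLocal.of_init hD (QF.same i j)
  | @between L hL i j =>
    rcases option_fin_succ_cases i with rfl | ⟨i, rfl⟩ <;>
      rcases option_fin_succ_cases j with rfl | ⟨j, rfl⟩
    · exact IsLocal.empty.congr fun q _ => ⟨fun h => Nat.not_succ_le_self _ h.1, fun h => h.elim⟩
    · refine (IsLocal.between_right hD hcut hL j).congr fun q _ => ?_
      rw [Marked.between, Set.mem_ofPred_eq, finish_castSucc]
      rfl
    · refine (IsLocal.between_left hD hcut hL i).congr fun q _ => ?_
      rw [Marked.between, Set.mem_ofPred_eq, start_castSucc]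
      rfl
    · refine (IsLocal.of_init hD (QF.between hL i j)).congr fun q _ => ?_
      rw [Marked.between, Set.mem_ofPred_eq, start_castSucc, finish_castSucc]
      rfl

/-- A position in the gap with factors in `M` and `N` around a letter `a` exists exactly when the
factor of the gap is in `M a N`. This is where a quantifier turns into a marked product. -/
theorem QF.image_box (hD : IsLatticeClass D)
    (hmul : ∀ K ∈ D, ∀ M ∈ D, ∀ a : A, K * {[a]} * M ∈ D) {y z : Option (Fin k)}
    {R : Set (Marked A (k + 1))} (hR : FinUnion (boxes D y z) R) :
    QF D k (init '' (R ∩ gap y z)) := by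
  induction hR with
  | bot => simpa using QF.empty
  | sup _ _ h₁ h₂ =>
    change QF D k (init '' ((_ ∪ _) ∩ _))
    rw [Set.union_inter_distrib_right, Set.image_union]
    exact h₁.union h₂
  | basic h =>
    obtain ⟨Q, M, a, N, hQ, hM, hN, rfl⟩ := h
    -- That no mark lies inside the gap is an order condition on the remaining marks.
    have hguard : QF D k (⋂ i, {p | (p.2 i).val < p.start y ∨ p.finish z ≤ (p.2 i).val}) := by
      refine QF.iInter fun i => QF.union (R := {p | (p.2 i).val < p.start y})
        (S := {p | p.finish z ≤ (p.2 i).val}) ?_ ?_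
      · rcases y with - | j
        · simpa [start] using QF.empty
        · convert (QF.same i j).union (QF.between hD.top_mem (some i) (some j)) using 1
          ext p
          simp only [Set.mem_ofPred_eq, Set.mem_union, QF.mem_between_top, start, finish,
            Marked.same, Nat.succ_le_iff, Nat.lt_succ_iff]
          rw [le_iff_eq_or_lt, Pos.val_inj]
      · rcases z with - | j
        · convert QF.empty
          ext p
          simpa [finish] using (p.2 i).isLt
        · convert (QF.same j i).union (QF.between hD.top_mem (some j) (some i)) using 1
          ext p
          simp only [Set.mem_ofPred_eq, Set.mem_union, QF.mem_between_top, start, finish,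
            Marked.same, Nat.succ_le_iff]
          rw [le_iff_eq_or_lt, Pos.val_inj]
    convert (hQ.inter hguard).inter (QF.between (hmul _ hM _ hN a) y z) using 1
    ext p
    constructor
    · rintro ⟨q, ⟨⟨h₁, h₂, h₃, h₄⟩, h₅, h₆, h₇⟩, rfl⟩
      refine ⟨⟨h₁, Set.mem_iInter.2 h₇⟩, h₅.trans h₆.le, mem_mul_singleton_mul.2
        ⟨_, _, h₂, h₄, ?_⟩⟩
      rw [List.getElem?_eq_getElem q.last_lt] at h₃
      obtain rfl := Option.some.inj h₃
      exact (factor_cut h₅ q.last_lt h₆).symm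
    · rintro ⟨⟨h₁, h₂⟩, h₃, h₄⟩
      obtain ⟨u, v, hu, hv, h⟩ := mem_mul_singleton_mul.1 h₄
      obtain ⟨x, hx, h₅, h₆, rfl, rfl, rfl⟩ := exists_of_factor_eq h.symm
      obtain ⟨x, rfl⟩ : ∃ i : Pos p.1, i.val = x := ⟨⟨x, hx⟩, rfl⟩
      refine ⟨p.snoc x, ⟨?_, ?_⟩, init_snoc _ _⟩
      · rw [box, Set.mem_ofPred_eq, init_snoc, last_snoc]
        exact ⟨h₁, hu, List.getElem?_eq_getElem hx, hv⟩
      · rw [gap, Set.mem_ofPred_eq, init_snoc, last_snoc]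
        exact ⟨h₅, h₆, Set.mem_iInter.1 h₂⟩

/-- Elimination of one existential quantifier. The forgotten mark is on one of the others, and is
then substituted by it, or in one of finitely many gaps, where `QF.isLocal` and `QF.image_box`
apply. -/
theorem QF.image_init [Finite A] (hD : IsLatticeClass D) (hcut : Cuttable D)
    (hmul : ∀ K ∈ D, ∀ M ∈ D, ∀ a : A, K * {[a]} * M ∈ D) {R : Set (Marked A (k + 1))}
    (hR : QF D (k + 1) R) : QF D k (init '' R) := by
  have h₁ : ∀ i : Fin k, QF D k (init '' (R ∩ {q | q.2 (Fin.last k) = q.init.2 i})) := by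
    intro i
    -- This reindexing puts the last mark on the mark `i` and keeps the others.
    convert hR.comap (Fin.lastCases (motive := fun _ => Fin k) i id) using 1
    have hq : ∀ q : Marked A (k + 1), q.2 (Fin.last k) = q.init.2 i →
        q.init.comap (Fin.lastCases (motive := fun _ => Fin k) i id) = q := by
      rintro ⟨w, xs⟩ h
      simp only [Marked.comap, init]
      congr 1
      ext j
      induction j using Fin.lastCases with
      | last => simpa [init, Marked.comap] using h.symm
      | cast j => simp
    ext p
    constructor
    · rintro ⟨q, ⟨h, h'⟩, rfl⟩
      rwa [Set.mem_preimage, hq q h']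
    · intro h
      refine ⟨_, ⟨h, ?_⟩, ?_⟩
      · simp [Marked.comap, init]
      · obtain ⟨w, xs⟩ := p
        simp only [Marked.comap, init]
        congr 1
        ext j
        simp
  have h₂ : ∀ yz : Option (Fin k) × Option (Fin k), QF D k (init '' (R ∩ gap yz.1 yz.2)) := by
    rintro ⟨y, z⟩
    obtain ⟨S, hS, h⟩ := hR.isLocal hD hcut y z
    have : R ∩ gap y z = S ∩ gap y z := Set.ext fun q => and_congr_left (h q)
    simp only [this]
    exact QF.image_box hD hmul hS
  convert (QF.iUnion h₁).union (QF.iUnion h₂) using 1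
  rw [← Set.image_iUnion, ← Set.image_iUnion, ← Set.image_union, ← Set.inter_iUnion,
    ← Set.inter_iUnion, ← Set.inter_union_distrib_left, Set.inter_eq_left.2]
  intro q _
  rcases exists_eq_or_mem_gap q with ⟨i, h⟩ | ⟨y, z, h⟩
  · exact .inl (Set.mem_iUnion.2 ⟨i, h⟩)
  · exact .inr (Set.mem_iUnion.2 ⟨(y, z), h⟩)

end Elimination

/-! ### Levels of the hierarchy -/

section Levels

variable {A : Type u} {C : Set (Language A)}

theorem fullLevel_isLatticeClass (hC : IsQuotientingBooleanAlgebra C) (n : ℕ) :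
    IsLatticeClass (fullLevel C n) := by
  cases n with
  | zero => exact hC.isLatticeClass
  | succ n => exact isLatticeClass_boolClosure _

theorem compl_mem_fullLevel (hC : IsQuotientingBooleanAlgebra C) (n : ℕ) :
    ∀ L ∈ fullLevel C n, Lᶜ ∈ fullLevel C n := by
  cases n with
  | zero => exact hC.compl_mem
  | succ n => exact fun _ h => BooleanSubalgebra.compl_mem h

theorem fullLevel_cuttable (hC : IsQuotientingBooleanAlgebra C) (hreg : ∀ L ∈ C, L.IsRegular)
    (n : ℕ) : Cuttable (fullLevel C n) := by
  induction n with
  | zero => exact hC.cuttable hreg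
  | succ n ih => exact ih.pol.boolClosure

theorem halfLevel_subset_fullLevel (n : ℕ) : halfLevel C n ⊆ fullLevel C (n + 1) :=
  subset_boolClosure _

end Levels

/-! ### Formulas and words with marked positions -/

section Logic

variable {A : Type u} {C : Set (Language A)} {k n : ℕ} {q : Kind}

theorem Kind.dual_dual (q : Kind) : q.dual.dual = q := by cases q <;> rfl

/-- The formulas with free variables `0, …, k - 1`. -/
abbrev Fml (C : Set (Language A)) (k : ℕ) := (signature C).BoundedFormula Empty k

/-- The words with `k` marked positions that satisfy a formula with `k` free variables. -/
def sat (φ : Fml C k) : Set (Marked A k) := {p | φ.Realize (fun x => x.elim) p.2}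

theorem mem_languageOf {φ : (signature C).Sentence} {w : List A} :
    w ∈ languageOf φ ↔ (⟨w, Fin.elim0⟩ : Marked A 0) ∈ sat φ := by
  change FirstOrder.Language.BoundedFormula.Realize φ default default ↔
    FirstOrder.Language.BoundedFormula.Realize φ _ _
  rw [Subsingleton.elim (default : Empty → Pos w) fun x => x.elim,
    Subsingleton.elim (default : Fin 0 → Pos w) Fin.elim0]

/-- The atomic formula given by a predicate symbol and variables. -/
def atom {l : ℕ} (R : Pred C l) (f : Fin l → Fin k) : Fml C k :=
  .rel (L := signature C) R fun i => .var (.inr (f i))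

theorem mem_sat_atom {l : ℕ} {R : Pred C l} {f : Fin l → Fin k} {p : Marked A k} :
    p ∈ sat (atom R f) ↔ interp p.1 R (p.2 ∘ f) := Iff.rfl

/-- There are no function symbols and no free variables outside `Fin k`, so every term is one of the
`k` variables. -/
theorem rel_eq_atom {l : ℕ} (R : (signature C).Relations l)
    (ts : Fin l → (signature C).Term (Empty ⊕ Fin k)) :
    ∃ f, FirstOrder.Language.BoundedFormula.rel R ts = atom (C := C) R f := by
  have h : ∀ t : (signature C).Term (Empty ⊕ Fin k), ∃ i, t = .var (.inr i) := by
    intro t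
    cases t with
    | var x =>
      rcases x with e | i
      · exact e.elim
      · exact ⟨i, rfl⟩
    | func f _ => exact Empty.elim f
  choose f hf using fun i => h (ts i)
  exact ⟨f, congrArg _ (funext hf)⟩

theorem mem_sat_all {φ : Fml C (k + 1)} {p : Marked A k} :
    p ∈ sat φ.all ↔ ∀ x, p.snoc x ∈ sat φ := Iff.rfl

theorem mem_sat_sup {φ ψ : Fml C k} {p : Marked A k} :
    p ∈ sat (φ ⊔ ψ) ↔ p ∈ sat φ ∨ p ∈ sat ψ :=
  FirstOrder.Language.BoundedFormula.realize_sup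

theorem mem_sat_inf {φ ψ : Fml C k} {p : Marked A k} :
    p ∈ sat (φ ⊓ ψ) ↔ p ∈ sat φ ∧ p ∈ sat ψ :=
  FirstOrder.Language.BoundedFormula.realize_inf

theorem mem_sat_ex {φ : Fml C (k + 1)} {p : Marked A k} :
    p ∈ sat φ.ex ↔ ∃ x, p.snoc x ∈ sat φ :=
  FirstOrder.Language.BoundedFormula.realize_ex

theorem compl_sat_all (φ : Fml C (k + 1)) : (sat φ.all)ᶜ = Marked.init '' (sat φ)ᶜ := by
  ext p
  rw [Set.mem_compl_iff, mem_sat_all, not_forall]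
  constructor
  · rintro ⟨x, hx⟩
    exact ⟨p.snoc x, hx, Marked.init_snoc p x⟩
  · rintro ⟨⟨w, xs⟩, h, rfl⟩
    refine ⟨xs (Fin.last k), ?_⟩
    have : Marked.snoc (Marked.init ⟨w, xs⟩) (xs (Fin.last k)) = ⟨w, xs⟩ := by
      simp only [Marked.snoc, Marked.init, Marked.comap]
      congr 1
      exact Fin.snoc_init_self xs
    rwa [this]

namespace IsAlt

theorem atom {l : ℕ} (R : Pred C l) (f : Fin l → Fin k) :
    IsAlt q n (ConcatHierarchy.atom R f) := .rel (C := C) R _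

theorem not {φ : Fml C k} (h : IsAlt q.dual n φ) : IsAlt q n φ.not := .imp h .falsum

theorem sup {φ ψ : Fml C k} (hφ : IsAlt q n φ) (hψ : IsAlt q n ψ) : IsAlt q n (φ ⊔ ψ) :=
  .imp (.not (by rwa [Kind.dual_dual])) hψ

theorem inf {φ ψ : Fml C k} (hφ : IsAlt q n φ) (hψ : IsAlt q n ψ) : IsAlt q n (φ ⊓ ψ) :=
  .not (.imp (by rwa [Kind.dual_dual]) (.not (by rwa [Kind.dual_dual])))

theorem ex {φ : Fml C (k + 1)} (h : IsAlt .sigma (n + 1) φ) : IsAlt .sigma (n + 1) φ.ex :=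
  .not (.all (.not h))

end IsAlt

/-- Raising the level allows any change of kind, so the kinds demanded by nested implications are
all available. -/
theorem IsBSigma.isAlt_succ {φ : Fml C k} (h : IsBSigma n φ) (q : Kind) : IsAlt q (n + 1) φ := by
  induction h generalizing q with
  | sigma h => exact .succ h
  | falsum => exact .falsum
  | imp _ _ h₁ h₂ => exact .imp (h₁ _) (h₂ _)

/-! ### From formulas to languages -/

theorem QF.atom {l : ℕ} (R : Pred C l) (f : Fin l → Fin k) : QF C k (sat (atom R f)) := by
  cases R with
  | label a => exact QF.label a (f 0)
  | I L => exact QF.between L.2 (some (f 0)) (some (f 1))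
  | P L =>
    convert QF.between L.2 none (some (f 0)) using 1
    exact Set.ext fun p => (and_iff_right (Nat.zero_le _)).symm
  | S L =>
    convert QF.between L.2 (some (f 0)) none using 1
    ext p
    refine Iff.trans ?_ (and_iff_right (Pos.isLt (p.2 (f 0)))).symm
    simp only [factor, Marked.finish, List.take_length]
    exact Iff.rfl
  | N L =>
    convert QF.between L.2 none none using 1
    ext p
    refine Iff.trans ?_ (and_iff_right (Nat.zero_le _)).symm
    simp only [factor, Marked.start, Marked.finish, List.take_length, List.drop_zero]
    exact Iff.rfl

/-- The sets of words with marked positions that are quantifier-free over the level of the hierarchy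
that corresponds to a kind of formulas; for `Π` formulas, that is a condition on the complement. -/
def IsLevelQF (C : Set (Language A)) (k : ℕ) : Kind → ℕ → Set (Marked A k) → Prop
  | _, 0, R => QF C k R
  | .sigma, n + 1, R => QF (halfLevel C n) k R
  | .pi, n + 1, R => QF (halfLevel C n) k Rᶜ

/-- Either kind at level `n` is quantifier-free over `C[n]`, which is closed under complement; the
kind is therefore forgotten before passing to `C[n+1/2]`. -/
theorem IsLevelQF.succ [Finite A] (hC : IsQuotientingBooleanAlgebra C) {R : Set (Marked A k)}
    (h : IsLevelQF C k q n R) (q' : Kind) : IsLevelQF C k q' (n + 1) R := by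
  have h' : QF (fullLevel C n) k R := by
    rcases n with - | n
    · exact h
    cases q with
    | sigma => exact h.mono (halfLevel_subset_fullLevel n)
    | pi =>
      rw [← compl_compl R]
      exact (h.mono (halfLevel_subset_fullLevel n)).compl (fullLevel_isLatticeClass hC _)
        (compl_mem_fullLevel hC _)
  cases q' with
  | sigma => exact h'.mono (subset_pol _)
  | pi =>
    exact (h'.compl (fullLevel_isLatticeClass hC _) (compl_mem_fullLevel hC _)).mono (subset_pol _)

theorem QF.isLevelQF [Finite A] (hC : IsQuotientingBooleanAlgebra C) {R : Set (Marked A k)}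
    (h : QF C k R) (q : Kind) (n : ℕ) : IsLevelQF C k q n R := by
  induction n generalizing q with
  | zero => exact h
  | succ n ih => exact (ih .sigma).succ hC q

/-- The only quantifier rule is `∀` for `Πₙ₊₁`. On complements it is a projection, and
`QF.image_init` applies because `C[n+1/2]` is a cuttable lattice closed under marked products. -/
theorem IsAlt.isLevelQF [Finite A] (hC : IsQuotientingBooleanAlgebra C)
    (hreg : ∀ L ∈ C, L.IsRegular) {φ : Fml C k} (h : IsAlt q n φ) :
    IsLevelQF C k q n (sat φ) := by
  induction h with
  | falsum => exact QF.empty.isLevelQF hC _ _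
  | rel R ts =>
    obtain ⟨f, hf⟩ := rel_eq_atom R ts
    rw [hf]
    exact (QF.atom R f).isLevelQF hC _ _
  | @imp q n k φ ψ _ _ h₁ h₂ =>
    have himp : sat (φ.imp ψ) = (sat φ)ᶜ ∪ sat ψ := Set.ext fun p => imp_iff_not_or
    rw [himp]
    rcases n with - | n
    · exact (QF.compl hC.isLatticeClass hC.compl_mem h₁).union h₂
    cases q with
    | sigma => exact QF.union h₁ h₂
    | pi =>
      change QF _ _ ((sat φ)ᶜ ∪ sat ψ)ᶜ
      rw [Set.compl_union, compl_compl]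
      exact QF.inter h₁ h₂
  | @all n k φ _ h =>
    change QF _ _ (sat φ.all)ᶜ
    rw [compl_sat_all]
    have hcut := fullLevel_cuttable hC hreg n
    exact QF.image_init (hcut.isLatticeClass_pol (fullLevel_isLatticeClass hC n)) hcut.pol
      (fun _ hK _ hM a => mul_mem_pol a hK hM) h
  | succ _ h => exact h.succ hC _

theorem languageOf_mem_of_QF {D : Set (Language A)} (hD : IsLatticeClass D)
    {φ : (signature C).Sentence} (h : QF D 0 (sat φ)) : languageOf φ ∈ D := by
  convert QF.mem_of_zero hD h using 1
  exact Language.ext fun w => mem_languageOf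

theorem IsSigma.languageOf_mem_halfLevel [Finite A] (hC : IsQuotientingBooleanAlgebra C)
    (hreg : ∀ L ∈ C, L.IsRegular) {φ : (signature C).Sentence} (h : IsSigma (n + 1) φ) :
    languageOf φ ∈ halfLevel C n :=
  languageOf_mem_of_QF ((fullLevel_cuttable hC hreg n).isLatticeClass_pol
    (fullLevel_isLatticeClass hC n)) (IsAlt.isLevelQF hC hreg h)

theorem IsBSigma.languageOf_mem_fullLevel [Finite A] (hC : IsQuotientingBooleanAlgebra C)
    (hreg : ∀ L ∈ C, L.IsRegular) {φ : (signature C).Sentence} (h : IsBSigma n φ) :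
    languageOf φ ∈ fullLevel C n := by
  have hl := fullLevel_isLatticeClass hC n
  refine languageOf_mem_of_QF hl ?_
  induction h with
  | sigma h =>
    have := IsAlt.isLevelQF hC hreg h
    rcases n with - | n
    · exact this
    · exact QF.mono (halfLevel_subset_fullLevel n) this
  | falsum => exact .empty
  | @imp φ ψ _ _ h₁ h₂ =>
    have himp : sat (φ.imp ψ) = (sat φ)ᶜ ∪ sat ψ := Set.ext fun p => imp_iff_not_or
    rw [himp]
    exact (h₁.compl hl (compl_mem_fullLevel hC n)).union h₂

/-! ### Relativization of formulas -/

/-- If the word `g w x` is embedded into `w` by `emb`, with a quantifier-free image and such that its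
atomic properties are quantifier-free in `w`, then so are the properties given by any formula, without
changing the quantifier alternation. -/
theorem IsAlt.exists_relativization (g : ∀ w : List A, Pos w → List A)
    (emb : ∀ w x, Pos (g w x) → Pos w)
    (hatom : ∀ {l k : ℕ} (R : Pred C l) (f : Fin l → Fin k), ∃ φ : Fml C (k + 1),
      (∀ q n, IsAlt q n φ) ∧ ∀ w x (xs : Fin k → Pos (g w x)),
        (⟨w, Fin.cons x (emb w x ∘ xs)⟩ : Marked A (k + 1)) ∈ sat φ ↔ interp (g w x) R (xs ∘ f))
    (hguard : ∀ k : ℕ, ∃ φ : Fml C (k + 1 + 1), (∀ q n, IsAlt q n φ) ∧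
      ∀ w x (xs : Fin k → Pos w) y,
        (⟨w, Fin.snoc (Fin.cons x xs : Fin (k + 1) → Pos w) y⟩ : Marked A (k + 1 + 1)) ∈ sat φ ↔
          y ∈ Set.range (emb w x))
    {φ : Fml C k} (h : IsAlt q n φ) : ∃ φ' : Fml C (k + 1), IsAlt q n φ' ∧
      ∀ w x (xs : Fin k → Pos (g w x)),
        (⟨w, Fin.cons x (emb w x ∘ xs)⟩ : Marked A (k + 1)) ∈ sat φ' ↔
          (⟨g w x, xs⟩ : Marked A k) ∈ sat φ := by
  induction h with
  | falsum => exact ⟨.falsum, .falsum, fun _ _ _ => Iff.rfl⟩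
  | rel R ts =>
    obtain ⟨f, hf⟩ := rel_eq_atom R ts
    obtain ⟨φ, hφ, h⟩ := hatom R f
    exact ⟨φ, hφ _ _, fun w x xs => by rw [hf, h]; rfl⟩
  | imp _ _ h₁ h₂ =>
    obtain ⟨φ, hφ, h₁⟩ := h₁
    obtain ⟨ψ, hψ, h₂⟩ := h₂
    exact ⟨φ.imp ψ, .imp hφ hψ, fun w x xs => imp_congr (h₁ w x xs) (h₂ w x xs)⟩
  | @all n k φ _ h =>
    obtain ⟨φ', hφ', h⟩ := h
    obtain ⟨γ, hγ, hg⟩ := hguard k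
    -- The guard is available at every kind and level, in particular at the dual kind required of a
    -- premise, so the alternation does not change.
    refine ⟨(γ.imp φ').all, .all (.imp (hγ _ _) hφ'), fun w x xs => ?_⟩
    rw [mem_sat_all, mem_sat_all]
    -- The parameter `x` stays the first variable and the bound variable is appended as the last
    -- one, so the two extensions commute.
    have hcons : ∀ y : Pos (g w x),
        (Fin.snoc (Fin.cons x (emb w x ∘ xs) : Fin (k + 1) → Pos w) (emb w x y) :
          Fin (k + 1 + 1) → Pos w) =
        Fin.cons x (emb w x ∘ (Fin.snoc xs y : Fin (k + 1) → Pos (g w x))) := by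
      intro y
      rw [Fin.comp_snoc]
      exact (Fin.cons_snoc_eq_snoc_cons x (emb w x ∘ xs) (emb w x y)).symm
    constructor
    · intro H y
      refine (h w x _).1 ?_
      rw [← hcons]
      exact H (emb w x y) ((hg _ _ _ _).2 ⟨y, rfl⟩)
    · intro H z hz
      obtain ⟨y, rfl⟩ := (hg _ _ _ _).1 hz
      change (⟨w, Fin.snoc _ _⟩ : Marked A (k + 1 + 1)) ∈ sat φ'
      rw [hcons]
      exact (h w x _).2 (H y)
  | succ _ h =>
    obtain ⟨φ', hφ', h⟩ := h
    exact ⟨φ', .succ hφ', h⟩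

/-- The position of `w` given by a position of its prefix before `x`. -/
def ofPrefix (w : List A) (x : Pos w) (i : Pos (w.take x.val)) : Pos w :=
  ⟨i.val, i.isLt.trans_le (List.length_take_le' _ _)⟩

/-- The position of `w` given by a position of its suffix after `x`. -/
def ofSuffix (w : List A) (x : Pos w) (i : Pos (w.drop (x.val + 1))) : Pos w :=
  ⟨x.val + 1 + i.val, by
    have := i.isLt
    rw [List.length_drop] at this
    omega⟩

theorem ofPrefix_val (w : List A) (x : Pos w) (i : Pos (w.take x.val)) :
    (ofPrefix w x i).val = i.val := rfl

theorem ofPrefix_lt (w : List A) (x : Pos w) (i : Pos (w.take x.val)) : i.val < x.val :=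
  i.isLt.trans_le (List.length_take_le _ _)

theorem ofSuffix_val (w : List A) (x : Pos w) (i : Pos (w.drop (x.val + 1))) :
    (ofSuffix w x i).val = x.val + 1 + i.val := rfl

theorem mem_range_ofPrefix {w : List A} {x y : Pos w} :
    y ∈ Set.range (ofPrefix w x) ↔ y.val < x.val := by
  constructor
  · rintro ⟨i, rfl⟩
    exact ofPrefix_lt w x i
  · intro h
    exact ⟨⟨y.val, by rw [List.length_take]; exact lt_min h y.isLt⟩, rfl⟩

theorem mem_range_ofSuffix {w : List A} {x y : Pos w} :
    y ∈ Set.range (ofSuffix w x) ↔ x.val < y.val := by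
  constructor
  · rintro ⟨i, rfl⟩
    rw [ofSuffix_val]
    omega
  · intro h
    have := y.isLt
    refine ⟨⟨y.val - (x.val + 1), by rw [List.length_drop]; omega⟩, Pos.val_inj.1 ?_⟩
    change x.val + 1 + (y.val - (x.val + 1)) = y.val
    omega

/-- In the prefix before `x`, a suffix is the infix up to `x`, so `S_L(i)` becomes `I_L(i, x)` and
`N_L` becomes `P_L(x)`; the other predicates are unchanged. Variable `0` is `x`. -/
theorem IsAlt.exists_prefix (hC : IsQuotientingBooleanAlgebra C) {φ : Fml C k}
    (h : IsAlt q n φ) : ∃ φ' : Fml C (k + 1), IsAlt q n φ' ∧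
      ∀ w x (xs : Fin k → Pos (w.take x.val)),
        (⟨w, Fin.cons x (ofPrefix w x ∘ xs)⟩ : Marked A (k + 1)) ∈ sat φ' ↔
          (⟨w.take x.val, xs⟩ : Marked A k) ∈ sat φ := by
  refine h.exists_relativization (fun w x => w.take x.val) ofPrefix ?_ ?_
  · intro l k R f
    cases R with
    | label a =>
      refine ⟨_, fun _ _ => .atom (.label a) fun _ => (f 0).succ, fun w x xs => ?_⟩
      have := ofPrefix_lt w x (xs (f 0))
      simp [mem_sat_atom, interp, ofPrefix_val, this]
    | I L =>
      refine ⟨_, fun _ _ => .atom (.I L) ![(f 0).succ, (f 1).succ], fun w x xs => ?_⟩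
      have := ofPrefix_lt w x (xs (f 1))
      simp [mem_sat_atom, interp, ofPrefix_val, List.take_take, this.le]
    | P L =>
      refine ⟨_, fun _ _ => .atom (.P L) fun _ => (f 0).succ, fun w x xs => ?_⟩
      have := ofPrefix_lt w x (xs (f 0))
      simp [mem_sat_atom, interp, ofPrefix_val, List.take_take, this.le]
    | S L =>
      refine ⟨_, fun _ _ => .atom (.I L) ![(f 0).succ, 0], fun w x xs => ?_⟩
      have := ofPrefix_lt w x (xs (f 0))
      simp [mem_sat_atom, interp, ofPrefix_val, this]
    | N L =>
      refine ⟨_, fun _ _ => .atom (.P L) fun _ => 0, fun w x xs => ?_⟩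
      simp [mem_sat_atom, interp]
  · intro k
    -- With the full language, `I` is the strict order, so the guard says `y < x`.
    refine ⟨_, fun _ _ => .atom (.I ⟨⊤, hC.top_mem⟩) ![Fin.last _, Fin.castSucc 0],
      fun w x xs y => ?_⟩
    rw [mem_range_ofPrefix]
    refine (and_iff_left trivial).trans ?_
    simp

/-- Dually, in the suffix after `x`, `P_L(i)` becomes `I_L(x, i)` and `N_L` becomes `S_L(x)`. -/
theorem IsAlt.exists_suffix (hC : IsQuotientingBooleanAlgebra C) {φ : Fml C k}
    (h : IsAlt q n φ) : ∃ φ' : Fml C (k + 1), IsAlt q n φ' ∧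
      ∀ w x (xs : Fin k → Pos (w.drop (x.val + 1))),
        (⟨w, Fin.cons x (ofSuffix w x ∘ xs)⟩ : Marked A (k + 1)) ∈ sat φ' ↔
          (⟨w.drop (x.val + 1), xs⟩ : Marked A k) ∈ sat φ := by
  refine h.exists_relativization (fun w x => w.drop (x.val + 1)) ofSuffix ?_ ?_
  · intro l k R f
    cases R with
    | label a =>
      refine ⟨_, fun _ _ => .atom (.label a) fun _ => (f 0).succ, fun w x xs => ?_⟩
      simp [mem_sat_atom, interp, ofSuffix_val]
    | I L =>
      refine ⟨_, fun _ _ => .atom (.I L) ![(f 0).succ, (f 1).succ], fun w x xs => ?_⟩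
      simp [mem_sat_atom, interp, ofSuffix_val, List.take_drop, add_assoc]
    | P L =>
      refine ⟨_, fun _ _ => .atom (.I L) ![0, (f 0).succ], fun w x xs => ?_⟩
      simp [mem_sat_atom, interp, ofSuffix_val, List.take_drop, add_assoc]
    | S L =>
      refine ⟨_, fun _ _ => .atom (.S L) fun _ => (f 0).succ, fun w x xs => ?_⟩
      simp [mem_sat_atom, interp, ofSuffix_val, add_assoc]
    | N L =>
      refine ⟨_, fun _ _ => .atom (.S L) fun _ => 0, fun w x xs => ?_⟩
      simp [mem_sat_atom, interp]
  · intro k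
    refine ⟨_, fun _ _ => .atom (.I ⟨⊤, hC.top_mem⟩) ![Fin.castSucc 0, Fin.last _],
      fun w x xs y => ?_⟩
    rw [mem_range_ofSuffix]
    refine (and_iff_left trivial).trans ?_
    simp

/-! ### From languages to formulas -/

/-- The quantified position is that of the separating letter `a`; the two sentences are relativized
to its two sides. Since the level is `n + 1` and the kind `Σ`, the outer `∃` is free. -/
theorem exists_isSigma_mul (hC : IsQuotientingBooleanAlgebra C) (a : A)
    {φ ψ : (signature C).Sentence} (hφ : IsSigma (n + 1) φ) (hψ : IsSigma (n + 1) ψ) :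
    ∃ χ : (signature C).Sentence, IsSigma (n + 1) χ ∧
      languageOf χ = languageOf φ * {[a]} * languageOf ψ := by
  obtain ⟨φ', hφ', h₁⟩ := IsAlt.exists_prefix hC hφ
  obtain ⟨ψ', hψ', h₂⟩ := IsAlt.exists_suffix hC hψ
  refine ⟨((atom (.label a) fun _ => 0) ⊓ (φ' ⊓ ψ') : Fml C 1).ex,
    .ex (.inf (.atom _ _) (.inf hφ' hψ')), Language.ext fun w => ?_⟩
  have h₁' : ∀ x : Pos w, (⟨w, Fin.snoc Fin.elim0 x⟩ : Marked A 1) ∈ sat φ' ↔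
      w.take x.val ∈ languageOf φ := fun x => by
    rw [mem_languageOf, ← h₁]
    congr! 2
    ext i
    obtain rfl : i = 0 := Fin.ext (by omega)
    rfl
  have h₂' : ∀ x : Pos w, (⟨w, Fin.snoc Fin.elim0 x⟩ : Marked A 1) ∈ sat ψ' ↔
      w.drop (x.val + 1) ∈ languageOf ψ := fun x => by
    rw [mem_languageOf, ← h₂]
    congr! 2
    ext i
    obtain rfl : i = 0 := Fin.ext (by omega)
    rfl
  rw [mem_languageOf, mem_sat_ex, mem_mul_singleton_mul]
  constructor
  · rintro ⟨x, hx⟩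
    obtain ⟨h₃, h₄⟩ := mem_sat_inf.1 hx
    obtain ⟨h₄, h₅⟩ := mem_sat_inf.1 h₄
    refine ⟨_, _, (h₁' x).1 h₄, (h₂' x).1 h₅, ?_⟩
    have h₆ : w[x.val]? = some a := h₃
    rw [List.getElem?_eq_getElem x.isLt] at h₆
    rw [← Option.some.inj h₆, List.cons_getElem_drop_succ, List.take_append_drop]
  · rintro ⟨u, v, hu, hv, rfl⟩
    obtain ⟨x, hx⟩ : ∃ x : Pos (u ++ a :: v), x.val = u.length :=
      ⟨⟨u.length, by simp⟩, rfl⟩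
    refine ⟨x, mem_sat_inf.2 ⟨?_, mem_sat_inf.2 ⟨(h₁' x).2 ?_, (h₂' x).2 ?_⟩⟩⟩
    · change (u ++ a :: v)[x.val]? = some a
      simp [hx]
    · simpa [hx] using hu
    · simpa [hx] using hv

theorem exists_isSigma_of_mem_pol (hC : IsQuotientingBooleanAlgebra C) {D : Set (Language A)}
    (hD : ∀ L ∈ D, ∃ φ : (signature C).Sentence, IsSigma (n + 1) φ ∧ languageOf φ = L)
    {L : Language A} (hL : L ∈ Pol D) :
    ∃ φ : (signature C).Sentence, IsSigma (n + 1) φ ∧ languageOf φ = L := by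
  rw [mem_pol_iff] at hL
  induction hL with
  | bot => exact ⟨.falsum, .falsum, rfl⟩
  | sup _ _ h₁ h₂ =>
    obtain ⟨φ, hφ, rfl⟩ := h₁
    obtain ⟨ψ, hψ, rfl⟩ := h₂
    refine ⟨(φ ⊔ ψ : Fml C 0), .sup hφ hψ, Language.ext fun w => ?_⟩
    rw [mem_languageOf, mem_sat_sup, ← mem_languageOf, ← mem_languageOf]
    rfl
  | basic h =>
    induction h with
    | base h => exact hD _ h
    | concat a hK _ ih =>
      obtain ⟨φ, hφ, rfl⟩ := hD _ hK
      obtain ⟨ψ, hψ, rfl⟩ := ih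
      exact exists_isSigma_mul hC a hφ hψ

theorem exists_isBSigma_of_mem_fullLevel (hC : IsQuotientingBooleanAlgebra C) (n : ℕ)
    {L : Language A} (hL : L ∈ fullLevel C n) :
    ∃ φ : (signature C).Sentence, IsBSigma n φ ∧ languageOf φ = L := by
  induction n generalizing L with
  | zero =>
    -- A language of the basis is defined by its own nullary predicate.
    refine ⟨atom (.N ⟨L, hL⟩) Fin.elim0, .sigma (.atom _ _), Language.ext fun w => ?_⟩
    rw [mem_languageOf]
    exact Iff.rfl
  | succ n ih =>
    induction hL using BooleanSubalgebra.closure_bot_sup_induction with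
    | mem L hL =>
      obtain ⟨φ, hφ, h⟩ := exists_isSigma_of_mem_pol (n := n) hC (fun K hK => by
        obtain ⟨φ, hφ, h⟩ := ih hK
        exact ⟨φ, hφ.isAlt_succ _, h⟩) hL
      exact ⟨φ, .sigma hφ, h⟩
    | bot => exact ⟨.falsum, .falsum, rfl⟩
    | sup K _ L _ hK hL =>
      obtain ⟨φ, hφ, rfl⟩ := hK
      obtain ⟨ψ, hψ, rfl⟩ := hL
      refine ⟨(φ ⊔ ψ : Fml C 0), .imp (.imp hφ .falsum) hψ, Language.ext fun w => ?_⟩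
      rw [mem_languageOf, mem_sat_sup, ← mem_languageOf, ← mem_languageOf]
      rfl
    | compl L _ hL =>
      obtain ⟨φ, hφ, rfl⟩ := hL
      refine ⟨φ.imp .falsum, .imp hφ .falsum, Language.ext fun w => ?_⟩
      rw [mem_languageOf]
      exact not_congr mem_languageOf.symm

end Logic

end ConcatHierarchy

/-! ### The correspondence between hierarchy and alternation -/

theorem mainTheorem3 {A : Type u} [Finite A] (C : Set (Language A))
    (hC : ConcatHierarchy.IsQuotientingBooleanAlgebra C) (hreg : ∀ L ∈ C, L.IsRegular)
    (n : ℕ) (L : Language A) :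
    (L ∈ ConcatHierarchy.fullLevel C n ↔
      ∃ φ : (ConcatHierarchy.signature C).Sentence,
        ConcatHierarchy.IsBSigma n φ ∧ ConcatHierarchy.languageOf φ = L) ∧
    (L ∈ ConcatHierarchy.halfLevel C n ↔
      ∃ φ : (ConcatHierarchy.signature C).Sentence,
        ConcatHierarchy.IsSigma (n + 1) φ ∧ ConcatHierarchy.languageOf φ = L) := by
  refine ⟨⟨ConcatHierarchy.exists_isBSigma_of_mem_fullLevel hC n, ?_⟩, ⟨fun h => ?_, ?_⟩⟩
  · rintro ⟨φ, hφ, rfl⟩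
    exact hφ.languageOf_mem_fullLevel hC hreg
  · refine ConcatHierarchy.exists_isSigma_of_mem_pol hC (fun K hK => ?_) h
    obtain ⟨φ, hφ, hK⟩ := ConcatHierarchy.exists_isBSigma_of_mem_fullLevel hC n hK
    exact ⟨φ, hφ.isAlt_succ _, hK⟩
  · rintro ⟨φ, hφ, rfl⟩
    exact hφ.languageOf_mem_halfLevel hC hreg
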